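/- Let $n\ge 0$ and $n_3\ge 1$ be integers. For a real third-order tensor $\mathcal A\in\mathbb R^{n_1\times n_2\times n_3}$ with frontal slices $A^{(1)},\dots,A^{(n_3)}\in\mathbb R^{n_1\times n_2}$ let $\mathtt{bcirc}(\mathcal A)\in\mathbb R^{n_1n_3\times n_2n_3}$ be the block circulant matrix whose block in position $(k,l)$ is $A^{(m)}$ with $m\equiv k-l+1 \pmod{n_3}$, let $\mathtt{unfold}(\mathcal A)\in\mathbb R^{n_1n_3\times n_2}$ be its first block column, and let $\mathtt{fold}$ be the inverse of $\mathtt{unfold}$. The t-product is $\mathcal A*\mathcal B=\mathtt{fold}(\mathtt{bcirc}(\mathcal A)\,\mathtt{unfold}(\mathcal B))$; the transpose $\mathcal A^{T}$ is obtained by transposing every frontal slice and reversing the order of the slices $2,\dots,n_3$; the norms are $\|\mathcal A\|_F=\big(\sum_{i,j,k}|a_{ijk}|^2\big)^{1/2}$ and $\|\mathcal A\|_2=\|\mathtt{bcirc}(\mathcal A)\|_2$ (the spectral norm of the matrix). For a symmetric t-positive semidefinite tensor $\mathcal X\in\mathbb R^{n\times n\times n_3}$ (one for which $\mathtt{bcirc}(\mathcal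 X)$ is symmetric positive semidefinite) and $r>0$ put $\mathcal X^r=\mathtt{fold}(\mathtt{bcirc}(\mathcal X)^r E_1)$, where $\mathtt{bcirc}(\mathcal X)^r$ is the power of a positive semidefinite matrix and $E_1\in\mathbb R^{nn_3\times n}$ is the first block column of the identity matrix. Finally $|\mathcal A|=(\mathcal A^{T}*\mathcal A)^{1/2}$ for $\mathcal A\in\mathbb R^{n\times n\times n_3}$. Let $1\le p,q\le\infty$ with $1/p+1/q=1$ (where $1/\infty=0$). Then for all $\mathcal A,\mathcal B,\mathcal C,\mathcal D\in\mathbb R^{n\times n\times n_3}$ $$2^{-|\frac1p-\frac12|}\,\big\|\mathcal C^{T}*\mathcal A+\mathcal D^{T}*\mathcal B\big\|_F\le n_3^{\frac1{2p}+\frac1{2q}-\frac12}\,\big\|\,|\mathcal A|^p+|\mathcal B|^p\,\big\|_F^{1/p}\,\big\|\,|\mathcal C|^q+|\mathcal D|^q\,\big\|_F^{1/q}$$ and $$2^{-|\frac1p-\frac12|}\,\big\|\mathcal C^{T}*\mathcal A+\mathcal D^{T}*\mathcal B\big\|_2\le \big\|\,|\mathcal A|^p+|\mathcal B|^p\,\big\|_2^{1/p}\,\big\|\,|\mathcal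 C|^q+|\mathcal D|^q\,\big\|_2^{1/q}.$$ Here, for an infinite exponent, $\big\|\,|\mathcal A|^\infty+|\mathcal B|^\infty\,\big\|^{1/\infty}$ denotes the limit $\lim_{r\to\infty}\big\|\,|\mathcal A|^r+|\mathcal B|^r\,\big\|^{1/r}$, which exists and equals $\max\{\|\mathcal A\|_2,\|\mathcal B\|_2\}$ both for the Frobenius norm and for the spectral norm. -/

import Mathlib

open Filter Topology
open scoped ENNReal

/-- Real third-order tensors of size `n₁ × n₂ × n₃`, given by their `n₃` frontal slices:
`A k i j` is the entry in row `i` and column `j` of the frontal slice with index `k`, where `k` is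
counted from `0`. Sums of tensors are entrywise. -/
abbrev Tensor3 (n₁ n₂ n₃ : ℕ) : Type :=
  Fin n₃ → Matrix (Fin n₁) (Fin n₂) ℝ

namespace Tensor3

variable {n₁ n₂ n₄ n n₃ : ℕ}

/-- The block circulant matrix of a tensor: its block in block-row `k` and block-column `l` is the
frontal slice with index `k - l` modulo `n₃`. -/
def bcirc (A : Tensor3 n₁ n₂ n₃) : Matrix (Fin n₃ × Fin n₁) (Fin n₃ × Fin n₂) ℝ :=
  Matrix.of fun r c => A (r.1 - c.1) r.2 c.2

/-- The block column of the frontal slices (the first block column of `bcirc A`). -/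
def unfold (A : Tensor3 n₁ n₂ n₃) : Matrix (Fin n₃ × Fin n₁) (Fin n₂) ℝ :=
  Matrix.of fun r j => A r.1 r.2 j

/-- The inverse of `unfold`. -/
def fold (M : Matrix (Fin n₃ × Fin n₁) (Fin n₂) ℝ) : Tensor3 n₁ n₂ n₃ :=
  fun k => Matrix.of fun i j => M (k, i) j

/-- The t-product `A * B = fold (bcirc A · unfold B)`. -/
def tprod (A : Tensor3 n₁ n₂ n₃) (B : Tensor3 n₂ n₄ n₃) : Tensor3 n₁ n₄ n₃ :=
  fold (bcirc A * unfold B)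

/-- The tensor transpose: every frontal slice is transposed, and the slice with index `k` is
exchanged with the one with index `-k` modulo `n₃` (so the slice with index `0` stays, the order of
all the others is reversed). -/
def ttranspose (A : Tensor3 n₁ n₂ n₃) : Tensor3 n₂ n₁ n₃ :=
  fun k => (A (-k)).transpose

/-- The Frobenius norm, the square root of the sum of the squares of all entries. -/
noncomputable def frobNorm (A : Tensor3 n₁ n₂ n₃) : ℝ :=
  Real.sqrt (∑ k, ∑ i, ∑ j, |A k i j| ^ 2)

open scoped Matrix.Norms.L2Operator in
/-- The spectral norm of a tensor: the operator norm of `bcirc A` with respect to the Euclidean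
norms. -/
noncomputable def specNorm (A : Tensor3 n₁ n₂ n₃) : ℝ :=
  ‖bcirc A‖

/-- The block column of height `n₃` whose first block is the identity and whose others vanish. -/
def firstBlock (n n₃ : ℕ) [NeZero n₃] : Matrix (Fin n₃ × Fin n) (Fin n) ℝ :=
  Matrix.of fun r j => if r.1 = 0 ∧ r.2 = j then 1 else 0

/-- The power `X ^ r` of a symmetric t-positive semidefinite tensor, as a tensor t-function
`f(X) = fold (f(bcirc X) · E₁)` with `f(x) = x ^ r`. The matrix `f(bcirc X)` is given by the
functional calculus of the real symmetric matrix `bcirc X`. -/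
noncomputable def tpow [NeZero n₃] (X : Tensor3 n n n₃) (r : ℝ) : Tensor3 n n n₃ :=
  fold (cfc (fun x : ℝ => x ^ r) (bcirc X) * firstBlock n n₃)

/-- The absolute value `|A| = (Aᵀ * A) ^ (1/2)`. -/
noncomputable def tabs [NeZero n₃] (A : Tensor3 n n n₃) : Tensor3 n n n₃ :=
  tpow (tprod (ttranspose A) A) (1 / 2)

/-- The quantity `‖ |A|^r + |B|^r ‖ ^ (1/r)` for a real exponent `r` and a norm `N`. -/
noncomputable def powSumNorm [NeZero n₃] (N : Tensor3 n n n₃ → ℝ) (r : ℝ)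
    (A B : Tensor3 n n n₃) : ℝ :=
  N (tpow (tabs A) r + tpow (tabs B) r) ^ (1 / r)

/-- The quantity `‖ |A|^p + |B|^p ‖ ^ (1/p)` for an exponent `p` that may be infinite. For `p = ∞`
this is the limit for `p → ∞`, which for the Frobenius norm as well as for the spectral norm is the
larger one of the spectral norms of `A` and `B`. -/
noncomputable def holderFactor [NeZero n₃] (N : Tensor3 n n n₃ → ℝ) (p : ℝ≥0∞)
    (A B : Tensor3 n n n₃) : ℝ :=
  if p = ∞ then max (specNorm A) (specNorm B) else powSumNorm N p.toReal A B

end Tensor3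

/-!
The map `bcirc` turns t-products into matrix products, transposes into transposes and tensor powers
into powers of positive semidefinite matrices (`bcirc_tprod`, `bcirc_ttranspose`, `bcirc_tpow`), and
`‖bcirc A‖_F ^ 2 = n₃ * ‖A‖_F ^ 2`. So both inequalities are statements about real matrices; the
powers of `n₃` cancel because `1 / p + 1 / q = 1`.

For matrices, stack `A, B` and `C, D` into block columns `Q` and `P`, so that
`Cᵀ * A + Dᵀ * B = Pᵀ * Q` and `Qᵀ * Q = X + Y` with `X = |A| ^ 2`, `Y = |B| ^ 2`. Hölder's
inequality for Schatten norms bounds `‖Pᵀ * Q‖` by `‖(Qᵀ * Q) ^ (p / 2)‖ ^ (1 / p)` times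
`‖(Pᵀ * P) ^ (q / 2)‖ ^ (1 / q)`. For the Frobenius norm this is the scalar Hölder inequality with
doubly stochastic weights (`frobSq_transpose_mul_le`), for the operator norm it is
submultiplicativity.

It remains to compare `(X + Y) ^ s` with `X ^ s + Y ^ s` for `s = p / 2`.
* For `1 ≤ s`, Jensen's inequality in an eigenbasis of `X + Y` gives the constant `2 ^ (s - 1)`
  (`eigenvalues_rpow_le`).
* For `1 / 2 ≤ s ≤ 1` the constant is `1`. In the Frobenius norm, Cauchy–Schwarz reduces this to
  `tr (Z ^ (2 * s - 1) * X) ≤ tr (Z ^ s * X ^ s)` for `0 ≤ X ≤ Z` (`sum_rpow_mul_diag_le`). Expanding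
  both sides in eigenbases of `Z` and `X` and bounding `t ^ s - t` below by `(1 - s) * (t - t ^ 2)`,
  one is left with `0 ≤ tr (g(Z) * (X - Z⁻¹ * X ^ 2))` for the monotone function
  `g(t) = t ^ (2 * s - 1)`. This follows from `X * Z⁻¹ * X ≤ X` by symmetrizing a double sum
  (`sum_monotone_mul_nonneg`). In the operator norm it suffices that `t ≤ t ^ s` on `[0, 1]`.

Of the conjugate exponents one is at least `2` and the other at most `2`, so the constants of the two
factors multiply to `2 ^ |1 / p - 1 / 2|`. At an infinite exponent the comparison is replaced by
`‖Q‖ ^ 2 ≤ ‖A‖ ^ 2 + ‖B‖ ^ 2`, and the limits come from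
`max ‖A‖ ‖B‖ ^ r ≤ ‖|A| ^ r + |B| ^ r‖ ≤ 2 * max ‖A‖ ‖B‖ ^ r` and the equivalence of norms.
-/

namespace Matrix

/-! ### Frobenius norm and Gram matrices -/

variable {ι κ : Type*} [Fintype κ]

lemma isHermitian_transpose_mul (P : Matrix κ ι ℝ) : (Pᵀ * P).IsHermitian := by
  simp [IsHermitian]

variable [Fintype ι]

lemma posSemidef_transpose_mul (P : Matrix κ ι ℝ) : (Pᵀ * P).PosSemidef := by
  simpa using posSemidef_conjTranspose_mul_self P

/-- The square of the Frobenius norm of a real matrix. -/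
def frobSq (M : Matrix ι κ ℝ) : ℝ := ∑ i, ∑ j, M i j ^ 2

lemma frobSq_nonneg (M : Matrix ι κ ℝ) : 0 ≤ frobSq M := by
  unfold frobSq; positivity

lemma frobSq_eq_trace (M : Matrix ι κ ℝ) : frobSq M = trace (Mᵀ * M) := by
  simp only [frobSq, trace, diag, mul_apply, transpose_apply, ← sq]
  exact Finset.sum_comm

lemma frobSq_transpose (M : Matrix ι κ ℝ) : frobSq Mᵀ = frobSq M :=
  Finset.sum_comm

variable [DecidableEq ι]

lemma frobSq_conj {U : Matrix ι ι ℝ} (hU : U * Uᵀ = 1) (M : Matrix ι ι ℝ) :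
    frobSq (Uᵀ * M * U) = frobSq M := by
  rw [frobSq_eq_trace, frobSq_eq_trace, trace_mul_comm]
  simp only [transpose_mul, transpose_transpose]
  rw [show Uᵀ * M * U * (Uᵀ * (Mᵀ * U)) = Uᵀ * (M * (U * Uᵀ) * Mᵀ * U) by
    simp only [Matrix.mul_assoc], hU, Matrix.mul_one, trace_mul_comm, Matrix.mul_assoc, hU,
    Matrix.mul_one, trace_mul_comm]

/-! ### Diagonalization of real symmetric matrices -/

namespace IsHermitian

variable {A : Matrix ι ι ℝ}

/-- The orthogonal matrix whose columns are the chosen eigenvectors of a symmetric matrix. -/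
noncomputable abbrev eigMat (hA : A.IsHermitian) : Matrix ι ι ℝ := hA.eigenvectorUnitary

lemma eigMat_transpose_mul (hA : A.IsHermitian) : hA.eigMatᵀ * hA.eigMat = 1 := by
  simpa [star_eq_conjTranspose] using Unitary.coe_star_mul_self hA.eigenvectorUnitary

lemma eigMat_mul_transpose (hA : A.IsHermitian) : hA.eigMat * hA.eigMatᵀ = 1 :=
  mul_eq_one_comm.mp hA.eigMat_transpose_mul

lemma cfc_eq_conj (hA : A.IsHermitian) (f : ℝ → ℝ) :
    _root_.cfc f A = hA.eigMat * diagonal (fun i => f (hA.eigenvalues i)) * hA.eigMatᵀ := by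
  rw [hA.cfc_eq, IsHermitian.cfc, Unitary.conjStarAlgAut_apply]
  simp [star_eq_conjTranspose, Function.comp_def]

lemma eq_conj (hA : A.IsHermitian) :
    A = hA.eigMat * diagonal hA.eigenvalues * hA.eigMatᵀ := by
  conv_lhs => rw [hA.spectral_theorem, Unitary.conjStarAlgAut_apply]
  simp [star_eq_conjTranspose]

lemma conj_eq_diagonal (hA : A.IsHermitian) :
    hA.eigMatᵀ * A * hA.eigMat = diagonal hA.eigenvalues := by
  rw [show hA.eigMatᵀ * A * hA.eigMat =
    hA.eigMatᵀ * (hA.eigMat * diagonal hA.eigenvalues * hA.eigMatᵀ) * hA.eigMat by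
      rw [← hA.eq_conj]]
  simp only [← Matrix.mul_assoc]
  rw [hA.eigMat_transpose_mul, Matrix.one_mul, Matrix.mul_assoc, hA.eigMat_transpose_mul,
    Matrix.mul_one]

end IsHermitian

lemma sum_sq_row {W : Matrix ι ι ℝ} (hW : W * Wᵀ = 1) (i : ι) : ∑ j, W i j ^ 2 = 1 := by
  simpa [mul_apply, sq] using congrFun (congrFun hW i) i

lemma sum_sq_col {W : Matrix ι ι ℝ} (hW : Wᵀ * W = 1) (j : ι) : ∑ i, W i j ^ 2 = 1 := by
  simpa [mul_apply, sq] using congrFun (congrFun hW j) j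

lemma conj_diagonal_apply_self (W : Matrix ι ι ℝ) (a : ι → ℝ) (i : ι) :
    (W * diagonal a * Wᵀ) i i = ∑ j, W i j ^ 2 * a j := by
  rw [mul_apply]
  simp only [mul_diagonal, transpose_apply]
  exact Finset.sum_congr rfl fun j _ => by ring

/-- The trace of a product of two diagonalized matrices is a double sum over the products of their
eigenvalues; the weights form a doubly stochastic matrix when `U` and `V` are orthogonal. -/
lemma trace_conj_mul_conj (U V : Matrix ι ι ℝ) (a b : ι → ℝ) :
    trace ((U * diagonal a * Uᵀ) * (V * diagonal b * Vᵀ)) =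
      ∑ i, ∑ j, (Uᵀ * V) i j ^ 2 * (a i * b j) := by
  have : (U * diagonal a * Uᵀ) * (V * diagonal b * Vᵀ) =
      U * (diagonal a * ((Uᵀ * V) * diagonal b * Vᵀ)) := by simp only [Matrix.mul_assoc]
  rw [this, trace_mul_comm, Matrix.mul_assoc,
    show (Uᵀ * V) * diagonal b * Vᵀ * U = (Uᵀ * V) * diagonal b * (Uᵀ * V)ᵀ by
      simp [Matrix.mul_assoc]]
  simp only [trace, diag, diagonal_mul, conj_diagonal_apply_self, Finset.mul_sum]
  exact Finset.sum_congr rfl fun i _ => Finset.sum_congr rfl fun j _ => by ring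

/-! ### Hölder's inequality for the Frobenius norm of a product -/

/-- Hölder's inequality with the doubly stochastic weights `W i j ^ 2`. -/
lemma sum_orthogonal_le_Lp_mul_Lq {W : Matrix ι ι ℝ} (hW : W * Wᵀ = 1) {p q : ℝ}
    (hpq : p.HolderConjugate q) {a b : ι → ℝ} (ha : ∀ i, 0 ≤ a i) (hb : ∀ i, 0 ≤ b i) :
    ∑ i, ∑ j, W i j ^ 2 * (a i * b j) ≤ (∑ i, a i ^ p) ^ (1 / p) * (∑ j, b j ^ q) ^ (1 / q) := by
  have hW' : Wᵀ * W = 1 := mul_eq_one_comm.mp hW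
  have hp := hpq.pos
  have hq := hpq.symm.pos
  have key := Real.inner_le_Lp_mul_Lq_of_nonneg (s := (Finset.univ : Finset (ι × ι)))
    (f := fun x => (W x.1 x.2 ^ 2) ^ (1 / p) * a x.1)
    (g := fun x => (W x.1 x.2 ^ 2) ^ (1 / q) * b x.2) hpq
    (fun x _ => mul_nonneg (by positivity) (ha _)) (fun x _ => mul_nonneg (by positivity) (hb _))
  have e1 : ∀ x : ι × ι, (W x.1 x.2 ^ 2) ^ (1 / p) * a x.1 * ((W x.1 x.2 ^ 2) ^ (1 / q) * b x.2) =
      W x.1 x.2 ^ 2 * (a x.1 * b x.2) := fun x => by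
    have : (W x.1 x.2 ^ 2) ^ (1 / p) * (W x.1 x.2 ^ 2) ^ (1 / q) = W x.1 x.2 ^ 2 := by
      rw [← Real.rpow_add_of_nonneg (by positivity) (by positivity) (by positivity)]
      simp [hpq.inv_add_inv_eq_one]
    linear_combination (a x.1 * b x.2) * this
  have e2 : ∀ x : ι × ι, ((W x.1 x.2 ^ 2) ^ (1 / p) * a x.1) ^ p = W x.1 x.2 ^ 2 * a x.1 ^ p :=
    fun x => by
      rw [Real.mul_rpow (by positivity) (ha _), ← Real.rpow_mul (by positivity),
        one_div_mul_cancel hp.ne', Real.rpow_one]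
  have e3 : ∀ x : ι × ι, ((W x.1 x.2 ^ 2) ^ (1 / q) * b x.2) ^ q = W x.1 x.2 ^ 2 * b x.2 ^ q :=
    fun x => by
      rw [Real.mul_rpow (by positivity) (hb _), ← Real.rpow_mul (by positivity),
        one_div_mul_cancel hq.ne', Real.rpow_one]
  simp only [e1, e2, e3, Fintype.sum_prod_type] at key
  simp only [← Finset.sum_mul, sum_sq_row hW, one_mul] at key
  rw [Finset.sum_comm (f := fun x y => W x y ^ 2 * b y ^ q)] at key
  simpa only [← Finset.sum_mul, sum_sq_col hW', one_mul] using key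

/-- The nonzero eigenvalues of `Pᵀ * P` and `P * Pᵀ` agree with multiplicities. -/
lemma sum_eigenvalues_transpose_mul_comm [DecidableEq κ] (P : Matrix κ ι ℝ)
    (h₁ : (Pᵀ * P).IsHermitian) (h₂ : (P * Pᵀ).IsHermitian) {f : ℝ → ℝ} (hf : f 0 = 0) :
    ∑ i, f (h₂.eigenvalues i) = ∑ i, f (h₁.eigenvalues i) := by
  have h := congrArg (fun p => (p.roots.map f).sum) (charpoly_mul_comm' Pᵀ P)
  have n1 := (charpoly_monic (Pᵀ * P)).ne_zero
  have n2 := (charpoly_monic (P * Pᵀ)).ne_zero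
  have nx : ∀ k, (Polynomial.X : Polynomial ℝ) ^ k ≠ 0 := fun k => pow_ne_zero _ Polynomial.X_ne_zero
  simp only [Polynomial.roots_mul (mul_ne_zero (nx _) n1),
    Polynomial.roots_mul (mul_ne_zero (nx _) n2), Multiset.map_add, Multiset.sum_add,
    Polynomial.roots_X_pow, Multiset.map_nsmul, Multiset.map_singleton, Multiset.sum_nsmul,
    Multiset.sum_singleton, hf, smul_zero, zero_add, h₁.roots_charpoly_eq_eigenvalues,
    h₂.roots_charpoly_eq_eigenvalues, Multiset.map_map] at h
  simpa using h.symm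

/-- Hölder's inequality for Schatten norms, in the form used here: the Frobenius norm of a product
against the norms with exponents `2 * p` and `2 * q`. -/
lemma frobSq_transpose_mul_le [DecidableEq κ] (P Q : Matrix κ ι ℝ) {p q : ℝ}
    (hpq : p.HolderConjugate q) :
    frobSq (Pᵀ * Q) ≤
      (∑ i, (isHermitian_transpose_mul Q).eigenvalues i ^ p) ^ (1 / p) *
      (∑ i, (isHermitian_transpose_mul P).eigenvalues i ^ q) ^ (1 / q) := by
  have hP : (P * Pᵀ).PosSemidef := by simpa using posSemidef_transpose_mul Pᵀ
  have hQ : (Q * Qᵀ).PosSemidef := by simpa using posSemidef_transpose_mul Qᵀ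
  have e : frobSq (Pᵀ * Q) = trace ((Q * Qᵀ) * (P * Pᵀ)) := by
    rw [frobSq_eq_trace]
    simp only [transpose_mul, transpose_transpose]
    rw [Matrix.mul_assoc, trace_mul_comm, trace_mul_comm (Q * Qᵀ)]
    simp only [Matrix.mul_assoc]
  rw [e, hQ.1.eq_conj, hP.1.eq_conj, trace_conj_mul_conj]
  rw [← sum_eigenvalues_transpose_mul_comm P _ hP.1 
      (f := (· ^ q)) (Real.zero_rpow hpq.symm.pos.ne'),
    ← sum_eigenvalues_transpose_mul_comm Q _ hQ.1 (f := (· ^ p))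
      (Real.zero_rpow hpq.pos.ne')]
  refine sum_orthogonal_le_Lp_mul_Lq ?_ hpq hQ.eigenvalues_nonneg hP.eigenvalues_nonneg
  rw [transpose_mul, transpose_transpose, Matrix.mul_assoc, ← Matrix.mul_assoc hP.1.eigMat,
    hP.1.eigMat_mul_transpose, Matrix.one_mul, hQ.1.eigMat_transpose_mul]

end Matrix

namespace Matrix

variable {ι : Type*} [Fintype ι] [DecidableEq ι]

/-! ### Comparison of `(X + Y) ^ s` with `X ^ s + Y ^ s` in the Frobenius norm -/

/-- If `0 ≤ K ≤ Z` with `Z` diagonal, then `K * Z⁻¹ * K ≤ K` on the diagonal. -/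
lemma sum_sq_mul_inv_le {K : Matrix ι ι ℝ} {z : ι → ℝ} (hK : K.PosSemidef)
    (hKz : (diagonal z - K).PosSemidef) (i : ι) : ∑ j, K i j ^ 2 * (z j)⁻¹ ≤ K i i := by
  set y : ι → ℝ := fun j => K i j * (z j)⁻¹ with hy
  have hsymm : ∀ a b, K a b = K b a := fun a b => by simpa using hK.1.apply b a
  have h1 := hK.dotProduct_mulVec_nonneg (Pi.single i 1 - y)
  have h2 := hKz.dotProduct_mulVec_nonneg y
  have e1 : y ⬝ᵥ (K *ᵥ Pi.single i 1) = ∑ j, K i j ^ 2 * (z j)⁻¹ := by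
    simp only [mulVec_single_one, dotProduct, hy]
    exact Finset.sum_congr rfl fun j _ => by rw [col_apply, hsymm j i]; ring
  have e2 : (Pi.single i 1 : ι → ℝ) ⬝ᵥ (K *ᵥ y) = ∑ j, K i j ^ 2 * (z j)⁻¹ := by
    rw [single_one_dotProduct, mulVec, dotProduct]
    exact Finset.sum_congr rfl fun j _ => by simp only [hy]; ring
  have e3 : y ⬝ᵥ (diagonal z *ᵥ y) = ∑ j, K i j ^ 2 * (z j)⁻¹ := by
    simp only [mulVec_diagonal, dotProduct, hy]
    refine Finset.sum_congr rfl fun j _ => ?_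
    rcases eq_or_ne (z j) 0 with h | h
    · simp [h]
    · field_simp
  have e4 : (Pi.single i 1 : ι → ℝ) ⬝ᵥ (K *ᵥ Pi.single i 1) = K i i := by simp
  simp only [star_trivial, sub_mulVec, mulVec_sub, dotProduct_sub, sub_dotProduct] at h1 h2
  linarith

/-- For `0 ≤ K ≤ Z` with `Z` diagonal and `g` monotone, the trace of `g(Z) * Z⁻¹ * (Z - K) * K` is
nonnegative. -/
lemma sum_monotone_mul_nonneg {K : Matrix ι ι ℝ} {z : ι → ℝ} (hK : K.PosSemidef)
    (hKz : (diagonal z - K).PosSemidef) (hz : ∀ i, 0 ≤ z i) {g : ℝ → ℝ}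
    (hg : MonotoneOn g (Set.Ici 0)) (hg0 : ∀ t, 0 ≤ t → 0 ≤ g t) :
    0 ≤ ∑ i, g (z i) * (K i i - (∑ j, K i j ^ 2) * (z i)⁻¹) := by
  have hsymm : ∀ a b, K a b = K b a := fun a b => by simpa using hK.1.apply b a
  -- a zero diagonal entry of `Z` forces the corresponding row of `K` to vanish
  have hzero : ∀ i j, z i = 0 → K i j = 0 := fun i j hi => by
    have hle : ∀ k, K k k ≤ z k := fun k => by simpa using hKz.diag_nonneg (i := k)
    have hKi : K i i = 0 := le_antisymm (hi ▸ hle i) hK.diag_nonneg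
    by_contra hij
    have h := hK.dotProduct_mulVec_nonneg
      ((-(K j j + 1) / (2 * K i j)) • Pi.single i 1 + Pi.single j 1)
    simp only [star_trivial, mulVec_add, mulVec_smul, dotProduct_add, add_dotProduct,
      smul_dotProduct, dotProduct_smul, mulVec_single_one, single_one_dotProduct, col_apply,
      smul_eq_mul, hKi, hsymm j i] at h
    have : -(K j j + 1) / (2 * K i j) * K i j = -(K j j + 1) / 2 := by field_simp
    linarith
  have key : ∑ i, g (z i) * ((∑ j, K i j ^ 2 * (z j)⁻¹) - (∑ j, K i j ^ 2) * (z i)⁻¹) ≤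
      ∑ i, g (z i) * (K i i - (∑ j, K i j ^ 2) * (z i)⁻¹) :=
    Finset.sum_le_sum fun i _ => mul_le_mul_of_nonneg_left
      (sub_le_sub_right (sum_sq_mul_inv_le hK hKz i) _) (hg0 _ (hz i))
  refine le_trans ?_ key
  have e : ∀ i, g (z i) * ((∑ j, K i j ^ 2 * (z j)⁻¹) - (∑ j, K i j ^ 2) * (z i)⁻¹) =
      ∑ j, K i j ^ 2 * (g (z i) * ((z j)⁻¹ - (z i)⁻¹)) := fun i => by
    rw [Finset.sum_mul, ← Finset.sum_sub_distrib, Finset.mul_sum]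
    exact Finset.sum_congr rfl fun j _ => by ring
  simp only [e]
  -- symmetrization in `i` and `j`
  have hs : ∑ i, ∑ j, K i j ^ 2 * (g (z i) * ((z j)⁻¹ - (z i)⁻¹)) =
      ∑ i, ∑ j, K i j ^ 2 * (g (z j) * ((z i)⁻¹ - (z j)⁻¹)) := by
    rw [Finset.sum_comm]
    exact Finset.sum_congr rfl fun j _ => Finset.sum_congr rfl fun i _ => by rw [hsymm i j]
  have h2 : 0 ≤ (∑ i, ∑ j, K i j ^ 2 * (g (z i) * ((z j)⁻¹ - (z i)⁻¹))) +
      ∑ i, ∑ j, K i j ^ 2 * (g (z j) * ((z i)⁻¹ - (z j)⁻¹)) := by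
    simp only [← Finset.sum_add_distrib]
    refine Finset.sum_nonneg fun i _ => Finset.sum_nonneg fun j _ => ?_
    rw [show K i j ^ 2 * (g (z i) * ((z j)⁻¹ - (z i)⁻¹)) +
      K i j ^ 2 * (g (z j) * ((z i)⁻¹ - (z j)⁻¹)) =
      K i j ^ 2 * ((g (z i) - g (z j)) * ((z j)⁻¹ - (z i)⁻¹)) by ring]
    rcases eq_or_lt_of_le (hz i) with hi | hi
    · simp [hzero i j hi.symm]
    rcases eq_or_lt_of_le (hz j) with hj | hj
    · simp [hsymm i j, hzero j i hj.symm]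
    refine mul_nonneg (sq_nonneg _) ?_
    rcases le_total (z i) (z j) with h | h
    · exact mul_nonneg_of_nonpos_of_nonpos (sub_nonpos.mpr (hg hi.le hj.le h))
        (sub_nonpos.mpr (inv_anti₀ hi h))
    · exact mul_nonneg (sub_nonneg.mpr (hg hj.le hi.le h)) (sub_nonneg.mpr (inv_anti₀ hj h))
  linarith

/-- A tangent line bound for `t ↦ t ^ s`, in homogeneous form. -/
lemma rpow_tangent_le {z x s : ℝ} (hz : 0 < z) (hx : 0 ≤ x) (hs0 : 0 < s) (hs1 : s ≤ 1) :
    z ^ (2 * s - 1) * (x + (1 - s) * (x - x ^ 2 * z⁻¹)) ≤ z ^ s * x ^ s := by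
  obtain ⟨t, rfl⟩ : ∃ t, x = z * t := ⟨x / z, by field_simp⟩
  have ht : 0 ≤ t := by rwa [mul_nonneg_iff_of_pos_left hz] at hx
  have e1 : z ^ (2 * s - 1) * z = z ^ s * z ^ s := by
    rw [← Real.rpow_add hz, ← Real.rpow_add_one hz.ne']
    ring_nf
  have e2 : z ^ (2 * s - 1) * (z * t + (1 - s) * (z * t - (z * t) ^ 2 * z⁻¹)) =
      z ^ s * z ^ s * (t * (1 - (1 - s) * (t - 1))) := by
    rw [← e1]
    field_simp
    ring
  have e3 : z ^ s * (z * t) ^ s = z ^ s * z ^ s * t ^ s := by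
    rw [Real.mul_rpow hz.le ht]
    ring
  have hzs : 0 ≤ z ^ s * z ^ s := by positivity
  rw [e2, e3]
  refine mul_le_mul_of_nonneg_left ?_ hzs
  have hts : 0 ≤ t ^ s := by positivity
  rcases le_total (1 - (1 - s) * (t - 1)) 0 with h | h
  · exact (mul_nonpos_of_nonneg_of_nonpos ht h).trans hts
  have hb := _root_.rpow_one_add_le_one_add_mul_self (s := t - 1) (by linarith) (p := 1 - s)
    (by linarith) (by linarith)
  rw [add_sub_cancel] at hb
  have ht2 : t ≤ t ^ s * (1 + (1 - s) * (t - 1)) := by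
    calc t = t ^ s * t ^ (1 - s) := by
          rw [← Real.rpow_add_of_nonneg ht hs0.le (by linarith)]; simp
      _ ≤ _ := mul_le_mul_of_nonneg_left hb hts
  calc t * (1 - (1 - s) * (t - 1))
      ≤ t ^ s * (1 + (1 - s) * (t - 1)) * (1 - (1 - s) * (t - 1)) :=
        mul_le_mul_of_nonneg_right ht2 h
    _ ≤ t ^ s := by nlinarith [mul_nonneg hts (sq_nonneg ((1 - s) * (t - 1)))]

/-- For `0 ≤ K ≤ Z` with `Z` diagonal, `tr (Z ^ (2 * s - 1) * K) ≤ tr (Z ^ s * K ^ s)`. -/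
lemma sum_rpow_mul_diag_le {V : Matrix ι ι ℝ} (hV : Vᵀ * V = 1) {x z : ι → ℝ}
    (hx : ∀ i, 0 ≤ x i) (hz : ∀ i, 0 ≤ z i)
    (hKz : (diagonal z - V * diagonal x * Vᵀ).PosSemidef) {s : ℝ} (hs0 : 1 / 2 ≤ s)
    (hs1 : s ≤ 1) :
    ∑ i, z i ^ (2 * s - 1) * (V * diagonal x * Vᵀ) i i ≤
      ∑ i, z i ^ s * (V * diagonal (fun j => x j ^ s) * Vᵀ) i i := by
  set K := V * diagonal x * Vᵀ with hKdef
  have hK : K.PosSemidef := by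
    simpa using (PosSemidef.diagonal (R := ℝ) (d := x) hx).mul_mul_conjTranspose_same V
  have hsymm : ∀ a b, K a b = K b a := fun a b => by simpa using hK.1.apply b a
  have hle : ∀ k, K k k ≤ z k := fun k => by simpa using hKz.diag_nonneg (i := k)
  have hcorr := sum_monotone_mul_nonneg hK hKz hz (g := fun t => t ^ (2 * s - 1))
    (fun a ha b _ hab => Real.rpow_le_rpow ha hab (by linarith))
    (fun t ht => Real.rpow_nonneg ht _)
  have hK2 : ∀ i, ∑ j, K i j ^ 2 = ∑ j, V i j ^ 2 * x j ^ 2 := fun i => by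
    have : K * K = V * diagonal (fun j => x j ^ 2) * Vᵀ := by
      rw [hKdef, show V * diagonal x * Vᵀ * (V * diagonal x * Vᵀ) =
        V * (diagonal x * (Vᵀ * V) * diagonal x) * Vᵀ by simp only [Matrix.mul_assoc], hV,
        Matrix.mul_one, diagonal_mul_diagonal]
      simp only [sq]
    rw [← conj_diagonal_apply_self, ← this, mul_apply]
    exact Finset.sum_congr rfl fun j _ => by rw [hsymm j i, sq]
  -- the tangent line bound, averaged with the weights `V i j ^ 2`; the row of a zero `z i` is zero
  have hi : ∀ i, z i ^ (2 * s - 1) * K i i +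
      (1 - s) * (z i ^ (2 * s - 1) * (K i i - (∑ j, K i j ^ 2) * (z i)⁻¹)) ≤
      z i ^ s * (V * diagonal (fun j => x j ^ s) * Vᵀ) i i := fun i => by
    rw [conj_diagonal_apply_self]
    rcases eq_or_lt_of_le (hz i) with h | h
    · have hKi : K i i = 0 := le_antisymm (h ▸ hle i) hK.diag_nonneg
      have e0 : (z i)⁻¹ = 0 := by rw [← h, _root_.inv_zero]
      rw [hKi, e0]
      simp only [mul_zero, sub_zero, add_zero]
      exact mul_nonneg (Real.rpow_nonneg (hz i) _) (Finset.sum_nonneg fun j _ =>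
        mul_nonneg (sq_nonneg _) (Real.rpow_nonneg (hx j) _))
    · rw [hK2, hKdef, conj_diagonal_apply_self, Finset.sum_mul, ← Finset.sum_sub_distrib,
        Finset.mul_sum, Finset.mul_sum, Finset.mul_sum, ← Finset.sum_add_distrib, Finset.mul_sum]
      refine Finset.sum_le_sum fun j _ => ?_
      have := mul_le_mul_of_nonneg_left (rpow_tangent_le h (hx j) (by linarith) hs1)
        (sq_nonneg (V i j))
      linarith
  have := Finset.sum_le_sum fun i (_ : i ∈ Finset.univ) => hi i
  rw [Finset.sum_add_distrib, ← Finset.mul_sum] at this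
  have := mul_nonneg (sub_nonneg.mpr hs1) hcorr
  linarith

lemma sum_conj_diag_sq_le_frobSq {U : Matrix ι ι ℝ} (hU : U * Uᵀ = 1) (M : Matrix ι ι ℝ) :
    ∑ i, (Uᵀ * M * U) i i ^ 2 ≤ frobSq M := by
  rw [← frobSq_conj hU M]
  exact Finset.sum_le_sum fun i _ =>
    Finset.single_le_sum (f := fun j => (Uᵀ * M * U) i j ^ 2) (fun j _ => sq_nonneg _)
      (Finset.mem_univ i)

lemma conj_conj_eq (U V : Matrix ι ι ℝ) (a : ι → ℝ) :
    Uᵀ * (V * diagonal a * Vᵀ) * U = (Uᵀ * V) * diagonal a * (Uᵀ * V)ᵀ := by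
  simp [Matrix.mul_assoc]

lemma orthogonal_transpose_mul {U V : Matrix ι ι ℝ} (hU : U * Uᵀ = 1) (hV : Vᵀ * V = 1) :
    (Uᵀ * V)ᵀ * (Uᵀ * V) = 1 := by
  rw [transpose_mul, transpose_transpose, Matrix.mul_assoc, ← Matrix.mul_assoc U, hU,
    Matrix.one_mul, hV]

/-- The case `1 / 2 ≤ s ≤ 1` of the comparison: the constant is `1`. -/
lemma sum_eigenvalues_rpow_le_frobSq_of_le_one {X Y : Matrix ι ι ℝ} (hX : X.PosSemidef)
    (hY : Y.PosSemidef) (hZ : (X + Y).PosSemidef) {s : ℝ} (hs0 : 1 / 2 ≤ s) (hs1 : s ≤ 1) :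
    ∑ i, hZ.1.eigenvalues i ^ (2 * s) ≤
      frobSq (cfc (fun x : ℝ => x ^ s) X + cfc (fun x : ℝ => x ^ s) Y) := by
  set U := hZ.1.eigMat
  set z := hZ.1.eigenvalues
  have hU : U * Uᵀ = 1 := hZ.1.eigMat_mul_transpose
  have hz : ∀ i, 0 ≤ z i := hZ.eigenvalues_nonneg
  have hsum : Uᵀ * X * U + Uᵀ * Y * U = diagonal z := by
    rw [← hZ.1.conj_eq_diagonal, Matrix.mul_add, Matrix.add_mul]
  have main : ∀ {T S : Matrix ι ι ℝ} (hT : T.PosSemidef), S.PosSemidef →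
      Uᵀ * T * U + Uᵀ * S * U = diagonal z →
      ∑ i, z i ^ (2 * s - 1) * (Uᵀ * T * U) i i ≤
        ∑ i, z i ^ s * (Uᵀ * cfc (fun x : ℝ => x ^ s) T * U) i i := by
    intro T S hT hS hTS
    have e : Uᵀ * T * U = (Uᵀ * hT.1.eigMat) * diagonal hT.1.eigenvalues *
        (Uᵀ * hT.1.eigMat)ᵀ := by
      rw [← conj_conj_eq, ← hT.1.eq_conj]
    rw [hT.1.cfc_eq_conj, conj_conj_eq, e]
    refine sum_rpow_mul_diag_le (orthogonal_transpose_mul hU hT.1.eigMat_transpose_mul)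
      hT.eigenvalues_nonneg hz ?_ hs0 hs1
    rw [← e, ← hTS, add_sub_cancel_left]
    simpa using hS.conjTranspose_mul_mul_same U
  have h1 := main hX hY hsum
  have h2 := main hY hX (by rw [add_comm, hsum])
  have hl : ∀ i, z i ^ (2 * s) =
      z i ^ (2 * s - 1) * (Uᵀ * X * U) i i + z i ^ (2 * s - 1) * (Uᵀ * Y * U) i i := fun i => by
    rw [← mul_add, ← add_apply, hsum, diagonal_apply_eq]
    rcases eq_or_lt_of_le (hz i) with h | h
    · rw [← h, Real.zero_rpow (by linarith), mul_zero]
    · rw [← Real.rpow_add_one h.ne', sub_add_cancel]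
  have hfin := sum_conj_diag_sq_le_frobSq hU
    (cfc (fun x : ℝ => x ^ s) X + cfc (fun x : ℝ => x ^ s) Y)
  -- `a * b ≤ a ^ 2 / 2 + b ^ 2 / 2` lets the sum of `z i ^ (2 * s)` be absorbed on the left
  have hcs : ∀ i, z i ^ s * (Uᵀ * cfc (fun x : ℝ => x ^ s) X * U) i i +
      z i ^ s * (Uᵀ * cfc (fun x : ℝ => x ^ s) Y * U) i i ≤ (1 / 2) * z i ^ (2 * s) +
      (1 / 2) * (Uᵀ * (cfc (fun x : ℝ => x ^ s) X + cfc (fun x : ℝ => x ^ s) Y) * U) i i ^ 2 :=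
    fun i => by
      rw [Matrix.mul_add, Matrix.add_mul, add_apply, mul_comm 2 s, Real.rpow_mul (hz i),
        Real.rpow_two]
      nlinarith [sq_nonneg (z i ^ s - ((Uᵀ * cfc (fun x : ℝ => x ^ s) X * U) i i +
        (Uᵀ * cfc (fun x : ℝ => x ^ s) Y * U) i i))]
  have hcs' := Finset.sum_le_sum fun i (_ : i ∈ Finset.univ) => hcs i
  have hl' := Finset.sum_congr rfl fun i (_ : i ∈ Finset.univ) => hl i
  simp only [Finset.sum_add_distrib, ← Finset.mul_sum] at hcs' hl'
  linarith

/-- Jensen's inequality `⟨u, T u⟩ ^ s ≤ ⟨u, T ^ s u⟩` for the columns `u` of an orthogonal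
matrix. -/
lemma conj_diag_rpow_le {U T : Matrix ι ι ℝ} (hU : U * Uᵀ = 1) (hT : T.PosSemidef) {s : ℝ}
    (hs : 1 ≤ s) (i : ι) :
    (Uᵀ * T * U) i i ^ s ≤ (Uᵀ * cfc (fun x : ℝ => x ^ s) T * U) i i := by
  have e : Uᵀ * T * U = (Uᵀ * hT.1.eigMat) * diagonal hT.1.eigenvalues *
      (Uᵀ * hT.1.eigMat)ᵀ := by
    rw [← conj_conj_eq, ← hT.1.eq_conj]
  rw [hT.1.cfc_eq_conj, conj_conj_eq, e, conj_diagonal_apply_self, conj_diagonal_apply_self]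
  exact Real.rpow_arith_mean_le_arith_mean_rpow _ _ _ (fun j _ => sq_nonneg _)
    (sum_sq_row (mul_eq_one_comm.mp
      (orthogonal_transpose_mul hU hT.1.eigMat_transpose_mul)) i)
    (fun j _ => hT.eigenvalues_nonneg j) hs

/-- In an eigenbasis of `X + Y` the powers of the eigenvalues are dominated by the diagonal entries
of `X ^ s + Y ^ s`, up to the constant `2 ^ (s - 1)`. -/
lemma eigenvalues_rpow_le {X Y : Matrix ι ι ℝ} (hX : X.PosSemidef)
    (hY : Y.PosSemidef) (hZ : (X + Y).PosSemidef) {s : ℝ} (hs : 1 ≤ s) (i : ι) :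
    hZ.1.eigenvalues i ^ s ≤ 2 ^ (s - 1) * (hZ.1.eigMatᵀ *
      (cfc (fun x : ℝ => x ^ s) X + cfc (fun x : ℝ => x ^ s) Y) * hZ.1.eigMat) i i := by
  have hU := hZ.1.eigMat_mul_transpose
  have hsum : hZ.1.eigenvalues i =
      (hZ.1.eigMatᵀ * X * hZ.1.eigMat) i i + (hZ.1.eigMatᵀ * Y * hZ.1.eigMat) i i := by
    rw [← add_apply, ← Matrix.add_mul, ← Matrix.mul_add, hZ.1.conj_eq_diagonal, diagonal_apply_eq]
  have hn : ∀ {T : Matrix ι ι ℝ}, T.PosSemidef → 0 ≤ (hZ.1.eigMatᵀ * T * hZ.1.eigMat) i i :=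
    fun hT => PosSemidef.diag_nonneg (by simpa using hT.conjTranspose_mul_mul_same hZ.1.eigMat)
  rw [hsum, Matrix.mul_add, Matrix.add_mul, add_apply]
  calc _ ≤ 2 ^ (s - 1) * ((hZ.1.eigMatᵀ * X * hZ.1.eigMat) i i ^ s +
        (hZ.1.eigMatᵀ * Y * hZ.1.eigMat) i i ^ s) := by
        have := NNReal.rpow_add_le_mul_rpow_add_rpow ⟨_, hn hX⟩ ⟨_, hn hY⟩ hs
        exact_mod_cast this
    _ ≤ _ := by
        gcongr
        · exact conj_diag_rpow_le hU hX hs i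
        · exact conj_diag_rpow_le hU hY hs i

/-- The case `1 ≤ s` of the comparison. -/
lemma sum_eigenvalues_rpow_le_frobSq_of_one_le {X Y : Matrix ι ι ℝ} (hX : X.PosSemidef)
    (hY : Y.PosSemidef) (hZ : (X + Y).PosSemidef) {s : ℝ} (hs : 1 ≤ s) :
    ∑ i, hZ.1.eigenvalues i ^ (2 * s) ≤ (2 ^ (s - 1)) ^ 2 *
      frobSq (cfc (fun x : ℝ => x ^ s) X + cfc (fun x : ℝ => x ^ s) Y) := by
  refine le_trans ?_ (mul_le_mul_of_nonneg_left
    (sum_conj_diag_sq_le_frobSq hZ.1.eigMat_mul_transpose _) (by positivity))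
  rw [Finset.mul_sum]
  refine Finset.sum_le_sum fun i _ => ?_
  rw [mul_comm 2 s, Real.rpow_mul (hZ.eigenvalues_nonneg i), Real.rpow_two, ← mul_pow]
  exact pow_le_pow_left₀ (Real.rpow_nonneg (hZ.eigenvalues_nonneg i) _)
    (eigenvalues_rpow_le hX hY hZ hs i) 2

end Matrix

namespace Matrix

variable {ι κ κ' : Type*} [Fintype ι] [DecidableEq ι] [Fintype κ] [Fintype κ']

/-! ### The operator norm -/

section OpNorm

open scoped Matrix.Norms.L2Operator

/-- The operator norm of a real matrix with respect to the Euclidean norms. -/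
noncomputable def opNorm (M : Matrix κ ι ℝ) : ℝ := ‖M‖

lemma opNorm_nonneg (M : Matrix κ ι ℝ) : 0 ≤ opNorm M := norm_nonneg M

lemma opNorm_add_le (M N : Matrix κ ι ℝ) : opNorm (M + N) ≤ opNorm M + opNorm N :=
  norm_add_le M N

lemma opNorm_mul_le [DecidableEq κ] (M : Matrix κ' κ ℝ) (N : Matrix κ ι ℝ) :
    opNorm (M * N) ≤ opNorm M * opNorm N := l2_opNorm_mul M N

lemma opNorm_transpose [DecidableEq κ] (M : Matrix κ ι ℝ) : opNorm Mᵀ = opNorm M := by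
  simpa [opNorm] using l2_opNorm_conjTranspose M

lemma opNorm_transpose_mul_self (M : Matrix κ ι ℝ) : opNorm (Mᵀ * M) = opNorm M ^ 2 := by
  simpa [opNorm, sq] using l2_opNorm_conjTranspose_mul_self M

lemma opNorm_diagonal (v : ι → ℝ) : opNorm (diagonal v) = ‖v‖ := l2_opNorm_diagonal v

lemma sum_sq_mulVec_le (M : Matrix κ ι ℝ) (v : ι → ℝ) :
    ∑ i, (M *ᵥ v) i ^ 2 ≤ opNorm M ^ 2 * ∑ j, v j ^ 2 := by
  have h := l2_opNorm_mulVec M (WithLp.toLp 2 v)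
  have h2 := pow_le_pow_left₀ (norm_nonneg _) h 2
  rw [mul_pow, EuclideanSpace.norm_sq_eq, EuclideanSpace.norm_sq_eq] at h2
  simpa [opNorm] using h2

lemma frobSq_mul_le [DecidableEq κ] {μ : Type*} [Fintype μ] (M : Matrix κ' κ ℝ)
    (N : Matrix κ μ ℝ) :
    frobSq (M * N) ≤ opNorm M ^ 2 * frobSq N := by
  rw [← frobSq_transpose (M * N), ← frobSq_transpose N, frobSq, frobSq, Finset.mul_sum]
  exact Finset.sum_le_sum fun j _ => sum_sq_mulVec_le M (fun k => N k j)

end OpNorm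

lemma opNorm_le_one_of_orthogonal {U : Matrix ι ι ℝ} (hU : Uᵀ * U = 1) : opNorm U ≤ 1 := by
  have h : opNorm U ^ 2 ≤ 1 := by
    rw [← opNorm_transpose_mul_self, hU, ← diagonal_one, opNorm_diagonal]
    exact (pi_norm_le_iff_of_nonneg zero_le_one).mpr fun i => by simp
  nlinarith [opNorm_nonneg U]

lemma opNorm_conj_le {U : Matrix ι ι ℝ} (hU : Uᵀ * U = 1) (M : Matrix ι ι ℝ) :
    opNorm (Uᵀ * M * U) ≤ opNorm M := by
  have h1 := opNorm_le_one_of_orthogonal hU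
  have h0 := opNorm_nonneg M
  calc opNorm (Uᵀ * M * U) ≤ opNorm Uᵀ * opNorm M * opNorm U :=
        (opNorm_mul_le _ _).trans (mul_le_mul_of_nonneg_right (opNorm_mul_le _ _) (opNorm_nonneg _))
    _ ≤ 1 * opNorm M * 1 := by
        rw [opNorm_transpose]
        have := opNorm_nonneg U
        gcongr
    _ = opNorm M := by ring

lemma abs_apply_le_opNorm (M : Matrix ι ι ℝ) (i j : ι) : |M i j| ≤ opNorm M := by
  have h := sum_sq_mulVec_le M (Pi.single j 1)
  have h1 : ∑ k, (Pi.single j 1 : ι → ℝ) k ^ 2 = 1 := by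
    simp [Pi.single_apply, ite_pow]
  rw [h1, mul_one, mulVec_single_one] at h
  exact abs_le_of_sq_le_sq ((Finset.single_le_sum (f := fun i => M.col j i ^ 2)
    (fun _ _ => sq_nonneg _) (Finset.mem_univ i)).trans h) (opNorm_nonneg M)

lemma conj_diag_le_opNorm {U : Matrix ι ι ℝ} (hU : Uᵀ * U = 1) (M : Matrix ι ι ℝ) (i : ι) :
    (Uᵀ * M * U) i i ≤ opNorm M :=
  (le_abs_self _).trans ((abs_apply_le_opNorm _ i i).trans (opNorm_conj_le hU M))

lemma opNorm_cfc_le {T : Matrix ι ι ℝ} (hT : T.IsHermitian) (f : ℝ → ℝ) {c : ℝ} (hc : 0 ≤ c)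
    (h : ∀ i, |f (hT.eigenvalues i)| ≤ c) : opNorm (cfc f T) ≤ c := by
  have e : cfc f T = hT.eigMatᵀᵀ * diagonal (fun i => f (hT.eigenvalues i)) * hT.eigMatᵀ := by
    rw [hT.cfc_eq_conj, transpose_transpose]
  rw [e]
  refine (opNorm_conj_le (by rw [transpose_transpose, hT.eigMat_mul_transpose]) _).trans ?_
  rw [opNorm_diagonal]
  exact (pi_norm_le_iff_of_nonneg hc).mpr h

lemma opNorm_le_of_eigenvalues_le {T : Matrix ι ι ℝ} (hT : T.PosSemidef) {c : ℝ} (hc : 0 ≤ c)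
    (h : ∀ i, hT.1.eigenvalues i ≤ c) : opNorm T ≤ c := by
  have e : cfc (fun x : ℝ => x) T = T := cfc_id' ℝ T hT.1
  rw [← e]
  exact opNorm_cfc_le hT.1 _ hc fun i => by rw [abs_of_nonneg (hT.eigenvalues_nonneg i)]; exact h i

lemma eigenvalues_le_opNorm {T : Matrix ι ι ℝ} (hT : T.IsHermitian) (i : ι) :
    hT.eigenvalues i ≤ opNorm T := by
  have := conj_diag_le_opNorm hT.eigMat_transpose_mul T i
  rwa [hT.conj_eq_diagonal, diagonal_apply_eq] at this

lemma opNorm_le_opNorm_add {X Y : Matrix ι ι ℝ} (hX : X.PosSemidef) (hY : Y.PosSemidef) :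
    opNorm X ≤ opNorm (X + Y) := by
  refine opNorm_le_of_eigenvalues_le hX (opNorm_nonneg _) fun i => ?_
  refine le_trans ?_ (conj_diag_le_opNorm hX.1.eigMat_transpose_mul (X + Y) i)
  rw [Matrix.mul_add, Matrix.add_mul, add_apply, hX.1.conj_eq_diagonal, diagonal_apply_eq]
  have : 0 ≤ (hX.1.eigMatᵀ * Y * hX.1.eigMat) i i :=
    PosSemidef.diag_nonneg (by simpa using hY.conjTranspose_mul_mul_same hX.1.eigMat)
  linarith

lemma PosSemidef.cfc_rpow {T : Matrix ι ι ℝ} (hT : T.PosSemidef) (s : ℝ) :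
    (cfc (fun x : ℝ => x ^ s) T).PosSemidef := by
  rw [hT.1.cfc_eq_conj]
  simpa using (PosSemidef.diagonal (R := ℝ) (d := fun i => hT.1.eigenvalues i ^ s)
    fun i => Real.rpow_nonneg (hT.eigenvalues_nonneg i) _).mul_mul_conjTranspose_same hT.1.eigMat

lemma conj_cfc_diag {T : Matrix ι ι ℝ} (hT : T.IsHermitian) (f : ℝ → ℝ) (i : ι) :
    (hT.eigMatᵀ * cfc f T * hT.eigMat) i i = f (hT.eigenvalues i) := by
  rw [hT.cfc_eq_conj, conj_conj_eq, hT.eigMat_transpose_mul]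
  simp

lemma opNorm_cfc_rpow {T : Matrix ι ι ℝ} (hT : T.PosSemidef) {s : ℝ} (hs : 0 < s) :
    opNorm (cfc (fun x : ℝ => x ^ s) T) = opNorm T ^ s := by
  refine le_antisymm ?_ ?_
  · refine opNorm_cfc_le hT.1 _ (Real.rpow_nonneg (opNorm_nonneg _) _) fun i => ?_
    have h0 := hT.eigenvalues_nonneg i
    rw [abs_of_nonneg (Real.rpow_nonneg h0 _)]
    exact Real.rpow_le_rpow h0 (eigenvalues_le_opNorm hT.1 i) hs.le
  · rw [← Real.le_rpow_inv_iff_of_pos (opNorm_nonneg _) (opNorm_nonneg _) hs]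
    refine opNorm_le_of_eigenvalues_le hT (Real.rpow_nonneg (opNorm_nonneg _) _) fun i => ?_
    rw [Real.le_rpow_inv_iff_of_pos (hT.eigenvalues_nonneg i) (opNorm_nonneg _) hs,
      ← conj_cfc_diag hT.1 (fun x : ℝ => x ^ s)]
    exact conj_diag_le_opNorm hT.1.eigMat_transpose_mul _ i

lemma opNorm_sq_le_frobSq {T : Matrix ι ι ℝ} (hT : T.PosSemidef) : opNorm T ^ 2 ≤ frobSq T := by
  refine Real.le_sqrt (opNorm_nonneg T) (frobSq_nonneg T) |>.mp ?_
  refine opNorm_le_of_eigenvalues_le hT (Real.sqrt_nonneg _) fun i => Real.le_sqrt_of_sq_le ?_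
  refine le_trans ?_ (sum_conj_diag_sq_le_frobSq hT.1.eigMat_mul_transpose T)
  rw [hT.1.conj_eq_diagonal]
  simpa using Finset.single_le_sum (f := fun i => hT.1.eigenvalues i ^ 2)
    (fun _ _ => sq_nonneg _) (Finset.mem_univ i)

/-! ### Comparison of `(X + Y) ^ s` with `X ^ s + Y ^ s` in the operator norm -/

/-- The operator norm analogue of the comparison for exponents `s ≤ 1`: after scaling to
`‖X + Y‖ = 1` it follows from `x ≤ x ^ s` on `[0, 1]`. -/
lemma opNorm_add_rpow_le_of_le_one {X Y : Matrix ι ι ℝ} (hX : X.PosSemidef)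
    (hY : Y.PosSemidef) {s : ℝ} (hs0 : 0 < s) (hs1 : s ≤ 1) :
    opNorm (X + Y) ^ s ≤
      opNorm (cfc (fun x : ℝ => x ^ s) X + cfc (fun x : ℝ => x ^ s) Y) := by
  have hZ := hX.add hY
  set c := opNorm (X + Y) with hc
  set N := opNorm (cfc (fun x : ℝ => x ^ s) X + cfc (fun x : ℝ => x ^ s) Y)
  rcases eq_or_lt_of_le (opNorm_nonneg (X + Y)) with h | h
  · rw [← hc] at h
    rw [← h, Real.zero_rpow hs0.ne']
    exact opNorm_nonneg _
  rw [← hc] at h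
  set U := hZ.1.eigMat
  have hU : U * Uᵀ = 1 := hZ.1.eigMat_mul_transpose
  have main : ∀ {T : Matrix ι ι ℝ} (hT : T.PosSemidef), opNorm T ≤ c → ∀ i,
      c ^ (s - 1) * (Uᵀ * T * U) i i ≤ (Uᵀ * cfc (fun x : ℝ => x ^ s) T * U) i i := by
    intro T hT hTc i
    have e : Uᵀ * T * U = (Uᵀ * hT.1.eigMat) * diagonal hT.1.eigenvalues *
        (Uᵀ * hT.1.eigMat)ᵀ := by
      rw [← conj_conj_eq, ← hT.1.eq_conj]
    rw [hT.1.cfc_eq_conj, conj_conj_eq, e, conj_diagonal_apply_self, conj_diagonal_apply_self,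
      Finset.mul_sum]
    refine Finset.sum_le_sum fun j _ => ?_
    have hx := hT.eigenvalues_nonneg j
    have hxc := (eigenvalues_le_opNorm hT.1 j).trans hTc
    have : c ^ (s - 1) * hT.1.eigenvalues j ≤ hT.1.eigenvalues j ^ s := by
      rcases eq_or_lt_of_le hx with h0 | h0
      · rw [← h0, mul_zero]
        exact Real.rpow_nonneg le_rfl _
      · calc c ^ (s - 1) * hT.1.eigenvalues j
            ≤ hT.1.eigenvalues j ^ (s - 1) * hT.1.eigenvalues j :=
              mul_le_mul_of_nonneg_right
                (Real.rpow_le_rpow_of_nonpos h0 hxc (by linarith)) hx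
          _ = hT.1.eigenvalues j ^ s := by rw [← Real.rpow_add_one h0.ne', sub_add_cancel]
    have := mul_le_mul_of_nonneg_left this (sq_nonneg ((Uᵀ * hT.1.eigMat) i j))
    linarith
  have hz : ∀ i, hZ.1.eigenvalues i ≤ N * c ^ (1 - s) := fun i => by
    have h1 := main hX (opNorm_le_opNorm_add hX hY) i
    have h2 := main hY ((opNorm_le_opNorm_add hY hX).trans_eq (by rw [add_comm, hc])) i
    have h3 := conj_diag_le_opNorm hZ.1.eigMat_transpose_mul
      (cfc (fun x : ℝ => x ^ s) X + cfc (fun x : ℝ => x ^ s) Y) i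
    have h4 : hZ.1.eigenvalues i = (Uᵀ * X * U) i i + (Uᵀ * Y * U) i i := by
      rw [← add_apply, ← Matrix.add_mul, ← Matrix.mul_add, hZ.1.conj_eq_diagonal,
        diagonal_apply_eq]
    rw [Matrix.mul_add, Matrix.add_mul, add_apply] at h3
    have h5 : c ^ (s - 1) * hZ.1.eigenvalues i ≤ N := by rw [h4, mul_add]; linarith
    calc hZ.1.eigenvalues i = c ^ (s - 1) * hZ.1.eigenvalues i * c ^ (1 - s) := by
          rw [mul_right_comm, ← Real.rpow_add h]; simp
      _ ≤ N * c ^ (1 - s) := by gcongr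
  have hcN := opNorm_le_of_eigenvalues_le hZ
    (mul_nonneg (opNorm_nonneg _) (Real.rpow_nonneg h.le _)) hz
  rw [← hc] at hcN
  have hpos : 0 < c ^ (1 - s) := by positivity
  refine le_of_mul_le_mul_right (a := c ^ (1 - s)) ?_ hpos
  rw [← Real.rpow_add h]
  simpa using hcN

lemma opNorm_add_rpow_le_of_one_le {X Y : Matrix ι ι ℝ} (hX : X.PosSemidef)
    (hY : Y.PosSemidef) {s : ℝ} (hs : 1 ≤ s) :
    opNorm (X + Y) ^ s ≤ 2 ^ (s - 1) *
      opNorm (cfc (fun x : ℝ => x ^ s) X + cfc (fun x : ℝ => x ^ s) Y) := by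
  have hZ := hX.add hY
  have hs0 : 0 < s := by linarith
  set N := opNorm (cfc (fun x : ℝ => x ^ s) X + cfc (fun x : ℝ => x ^ s) Y)
  have hN : 0 ≤ (2 : ℝ) ^ (s - 1) * N := mul_nonneg (by positivity) (opNorm_nonneg _)
  rw [← Real.le_rpow_inv_iff_of_pos (opNorm_nonneg _) hN hs0]
  refine opNorm_le_of_eigenvalues_le hZ (Real.rpow_nonneg hN _) fun i => ?_
  rw [Real.le_rpow_inv_iff_of_pos (hZ.eigenvalues_nonneg i) hN hs0]
  exact (eigenvalues_rpow_le hX hY hZ hs i).trans (mul_le_mul_of_nonneg_left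
    (conj_diag_le_opNorm hZ.1.eigMat_transpose_mul _ i) (by positivity))

end Matrix

namespace Matrix

variable {ι : Type*} [Fintype ι]

/-! ### Hölder-type inequalities for two pairs of matrices -/

lemma fromRows_transpose_mul_fromRows (C D A B : Matrix ι ι ℝ) :
    (fromRows C D)ᵀ * fromRows A B = Cᵀ * A + Dᵀ * B := by
  rw [transpose_fromRows, fromCols_mul_fromRows]

lemma frobSq_add_swap (A B C D : Matrix ι ι ℝ) :
    frobSq (Cᵀ * A + Dᵀ * B) = frobSq (Aᵀ * C + Bᵀ * D) := by
  rw [← frobSq_transpose]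
  simp

variable [DecidableEq ι]

/-- The matrix `(Aᵀ * A) ^ s + (Bᵀ * B) ^ s`, which is `|A| ^ (2 * s) + |B| ^ (2 * s)`. -/
noncomputable def gramPowSum (s : ℝ) (A B : Matrix ι ι ℝ) : Matrix ι ι ℝ :=
  cfc (fun x : ℝ => x ^ s) (Aᵀ * A) + cfc (fun x : ℝ => x ^ s) (Bᵀ * B)

lemma posSemidef_gramPowSum (s : ℝ) (A B : Matrix ι ι ℝ) : (gramPowSum s A B).PosSemidef :=
  ((posSemidef_transpose_mul A).cfc_rpow s).add ((posSemidef_transpose_mul B).cfc_rpow s)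

/-- The comparison for `X = |A| ^ 2`, `Y = |B| ^ 2` and `s = p / 2`, both ranges of `s` at once. -/
lemma sum_eigenvalues_rpow_le_frobSq_gramPowSum (A B : Matrix ι ι ℝ) {p : ℝ} (hp : 1 ≤ p)
    (h : (Aᵀ * A + Bᵀ * B).IsHermitian) :
    ∑ i, h.eigenvalues i ^ p ≤
      ((2 : ℝ) ^ max (p / 2 - 1) 0) ^ 2 * frobSq (gramPowSum (p / 2) A B) := by
  have hZ := (posSemidef_transpose_mul A).add (posSemidef_transpose_mul B)
  have e : p = 2 * (p / 2) := by ring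
  rcases le_total (p / 2) 1 with h1 | h1
  · rw [max_eq_right (by linarith), Real.rpow_zero, one_pow, one_mul]
    conv_lhs => rw [e]
    exact sum_eigenvalues_rpow_le_frobSq_of_le_one (posSemidef_transpose_mul A)
      (posSemidef_transpose_mul B) hZ (by linarith) h1
  · rw [max_eq_left (by linarith)]
    conv_lhs => rw [e]
    exact sum_eigenvalues_rpow_le_frobSq_of_one_le (posSemidef_transpose_mul A)
      (posSemidef_transpose_mul B) hZ h1

lemma opNorm_add_rpow_le_gramPowSum (A B : Matrix ι ι ℝ) {s : ℝ} (hs : 0 < s) :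
    opNorm (Aᵀ * A + Bᵀ * B) ^ s ≤ 2 ^ max (s - 1) 0 * opNorm (gramPowSum s A B) := by
  rcases le_total s 1 with h1 | h1
  · rw [max_eq_right (by linarith), Real.rpow_zero, one_mul]
    exact opNorm_add_rpow_le_of_le_one (posSemidef_transpose_mul A)
      (posSemidef_transpose_mul B) hs h1
  · rw [max_eq_left (by linarith)]
    exact opNorm_add_rpow_le_of_one_le (posSemidef_transpose_mul A)
      (posSemidef_transpose_mul B) h1

/-- The exponents of the constants that the comparison contributes for `p` and for `q` add up to
`|1 / p - 1 / 2|`. -/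
lemma two_rpow_mul_two_rpow {p q : ℝ} (hpq : p.HolderConjugate q) :
    ((2 : ℝ) ^ max (p / 2 - 1) 0) ^ (1 / p) * ((2 : ℝ) ^ max (q / 2 - 1) 0) ^ (1 / q) =
      2 ^ |1 / p - 1 / 2| := by
  have hp := hpq.pos
  have hq := hpq.symm.pos
  have h := hpq.inv_add_inv_eq_one
  rw [← Real.rpow_mul zero_le_two, ← Real.rpow_mul zero_le_two, ← Real.rpow_add two_pos,
    max_mul_of_nonneg _ _ (by positivity), max_mul_of_nonneg _ _ (by positivity)]
  have e1 : (p / 2 - 1) * (1 / p) = 1 / 2 - p⁻¹ := by field_simp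
  have e2 : (q / 2 - 1) * (1 / q) = p⁻¹ - 1 / 2 := by
    have : (q / 2 - 1) * (1 / q) = 1 / 2 - q⁻¹ := by field_simp
    linarith
  rw [e1, e2, zero_mul, zero_mul, one_div p]
  congr 1
  rcases le_total p⁻¹ (1 / 2) with h | h
  · rw [max_eq_left (by linarith), max_eq_right (by linarith), abs_of_nonpos (by linarith)]
    ring
  · rw [max_eq_right (by linarith), max_eq_left (by linarith), abs_of_nonneg (by linarith)]
    ring

lemma frobenius_holder (A B C D : Matrix ι ι ℝ) {p q : ℝ} (hpq : p.HolderConjugate q) :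
    √(frobSq (Cᵀ * A + Dᵀ * B)) ≤ 2 ^ |1 / p - 1 / 2| *
      (√(frobSq (gramPowSum (p / 2) A B)) ^ (1 / p) *
        √(frobSq (gramPowSum (q / 2) C D)) ^ (1 / q)) := by
  have main := frobSq_transpose_mul_le (fromRows C D) (fromRows A B) hpq
  rw [fromRows_transpose_mul_fromRows] at main
  have hs : ∀ {r : ℝ} (_ : 1 ≤ r) (A B : Matrix ι ι ℝ),
      (∑ i, (isHermitian_transpose_mul (fromRows A B)).eigenvalues i ^ r) ^ (1 / r) ≤
        (((2 : ℝ) ^ max (r / 2 - 1) 0) ^ (1 / r) *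
          √(frobSq (gramPowSum (r / 2) A B)) ^ (1 / r)) ^ 2 := by
    intro r hr A B
    have h := isHermitian_transpose_mul (fromRows A B)
    have h1 : ∑ i, h.eigenvalues i ^ r ≤
        ((2 : ℝ) ^ max (r / 2 - 1) 0) ^ 2 * frobSq (gramPowSum (r / 2) A B) := by
      -- the eigenvalues depend on the matrix through `h`, which is rewritten along with it
      revert h
      rw [fromRows_transpose_mul_fromRows]
      exact fun h => sum_eigenvalues_rpow_le_frobSq_gramPowSum A B hr h
    refine (Real.rpow_le_rpow (Finset.sum_nonneg fun i _ => Real.rpow_nonneg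
      ((posSemidef_transpose_mul (fromRows A B)).eigenvalues_nonneg i) _) h1
      (by positivity)).trans_eq ?_
    rw [← Real.mul_rpow (by positivity) (by positivity), Real.rpow_pow_comm
      (x := 2 ^ max (r / 2 - 1) 0 * √(frobSq (gramPowSum (r / 2) A B))) (by positivity), mul_pow,
      Real.sq_sqrt (frobSq_nonneg _)]
  have h2 := main.trans (mul_le_mul (hs hpq.lt.le A B) (hs hpq.symm.lt.le C D)
    (Real.rpow_nonneg (Finset.sum_nonneg fun i _ => Real.rpow_nonneg
      ((posSemidef_transpose_mul (fromRows C D)).eigenvalues_nonneg i) _) _) (by positivity))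
  rw [← mul_pow] at h2
  refine (Real.sqrt_le_left (by positivity) |>.mpr h2).trans_eq ?_
  rw [← two_rpow_mul_two_rpow hpq]
  ring

lemma opNorm_fromRows_sq (A B : Matrix ι ι ℝ) :
    opNorm (fromRows A B) ^ 2 = opNorm (Aᵀ * A + Bᵀ * B) := by
  rw [← opNorm_transpose_mul_self, fromRows_transpose_mul_fromRows]

lemma opNorm_fromRows_le (A B : Matrix ι ι ℝ) {p : ℝ} (hp : 0 < p) :
    opNorm (fromRows A B) ≤ ((2 : ℝ) ^ max (p / 2 - 1) 0) ^ (1 / p) *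
      opNorm (gramPowSum (p / 2) A B) ^ (1 / p) := by
  have h := opNorm_add_rpow_le_gramPowSum A B (half_pos hp)
  have h0 := opNorm_nonneg (fromRows A B)
  rw [← opNorm_fromRows_sq, ← Real.rpow_two, ← Real.rpow_mul h0, mul_div_cancel₀ _ two_ne_zero] at h
  rw [← Real.mul_rpow (by positivity) (opNorm_nonneg _), one_div, Real.le_rpow_inv_iff_of_pos h0
    (mul_nonneg (by positivity) (opNorm_nonneg _)) hp]
  exact h

lemma opNorm_fromRows_le_max (A B : Matrix ι ι ℝ) :
    opNorm (fromRows A B) ≤ 2 ^ (1 / 2 : ℝ) * max (opNorm A) (opNorm B) := by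
  have hA := opNorm_nonneg A
  have hB := opNorm_nonneg B
  have hm : 0 ≤ max (opNorm A) (opNorm B) := le_max_of_le_left hA
  have h : opNorm (fromRows A B) ^ 2 ≤ (2 ^ (1 / 2 : ℝ) * max (opNorm A) (opNorm B)) ^ 2 := by
    rw [opNorm_fromRows_sq, mul_pow, ← Real.rpow_two, ← Real.rpow_mul zero_le_two]
    have h1 := opNorm_add_le (Aᵀ * A) (Bᵀ * B)
    rw [opNorm_transpose_mul_self, opNorm_transpose_mul_self] at h1
    have h2 := pow_le_pow_left₀ hA (le_max_left (opNorm A) (opNorm B)) 2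
    have h3 := pow_le_pow_left₀ hB (le_max_right (opNorm A) (opNorm B)) 2
    norm_num
    linarith
  exact le_of_sq_le_sq h (by positivity)

lemma opNorm_transpose_mul_add_le (A B C D : Matrix ι ι ℝ) :
    opNorm (Cᵀ * A + Dᵀ * B) ≤ opNorm (fromRows A B) * opNorm (fromRows C D) := by
  rw [← fromRows_transpose_mul_fromRows, mul_comm, ← opNorm_transpose (fromRows C D)]
  exact opNorm_mul_le _ _

lemma opNorm_holder (A B C D : Matrix ι ι ℝ) {p q : ℝ} (hpq : p.HolderConjugate q) :
    opNorm (Cᵀ * A + Dᵀ * B) ≤ 2 ^ |1 / p - 1 / 2| *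
      (opNorm (gramPowSum (p / 2) A B) ^ (1 / p) *
        opNorm (gramPowSum (q / 2) C D) ^ (1 / q)) := by
  have h1 := opNorm_nonneg (gramPowSum (p / 2) A B)
  refine (opNorm_transpose_mul_add_le A B C D).trans
    ((mul_le_mul (opNorm_fromRows_le A B hpq.pos) (opNorm_fromRows_le C D hpq.symm.pos)
      (opNorm_nonneg _) (by positivity)).trans_eq ?_)
  rw [← two_rpow_mul_two_rpow hpq]
  ring

/-- The case of the exponents `∞` and `1`. -/
lemma opNorm_holder_top (A B C D : Matrix ι ι ℝ) :
    opNorm (Cᵀ * A + Dᵀ * B) ≤ 2 ^ (1 / 2 : ℝ) *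
      (max (opNorm A) (opNorm B) * opNorm (gramPowSum (1 / 2) C D)) := by
  have h := opNorm_fromRows_le C D one_pos
  norm_num at h
  have hm : 0 ≤ max (opNorm A) (opNorm B) := le_max_of_le_left (opNorm_nonneg A)
  rw [← mul_assoc]
  exact (opNorm_transpose_mul_add_le A B C D).trans
    (mul_le_mul (opNorm_fromRows_le_max A B) h (opNorm_nonneg _) (by positivity))

/-- The case of the exponents `∞` and `1`. -/
lemma frobenius_holder_top (A B C D : Matrix ι ι ℝ) :
    √(frobSq (Cᵀ * A + Dᵀ * B)) ≤ 2 ^ (1 / 2 : ℝ) *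
      (max (opNorm A) (opNorm B) * √(frobSq (gramPowSum (1 / 2) C D))) := by
  have hm : 0 ≤ max (opNorm A) (opNorm B) := le_max_of_le_left (opNorm_nonneg A)
  have hP : frobSq (fromRows C D) ≤ frobSq (gramPowSum (1 / 2) C D) := by
    have hZ := (posSemidef_transpose_mul C).add (posSemidef_transpose_mul D)
    have h := sum_eigenvalues_rpow_le_frobSq_gramPowSum C D le_rfl hZ.1
    norm_num at h
    rw [frobSq_eq_trace, fromRows_transpose_mul_fromRows, hZ.1.trace_eq_sum_eigenvalues]
    simpa using h
  have h1 : frobSq (Cᵀ * A + Dᵀ * B) ≤ (2 ^ (1 / 2 : ℝ) * max (opNorm A) (opNorm B)) ^ 2 *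
      frobSq (gramPowSum (1 / 2) C D) := by
    have e : Cᵀ * A + Dᵀ * B = ((fromRows A B)ᵀ * fromRows C D)ᵀ := by
      rw [← fromRows_transpose_mul_fromRows, transpose_mul, transpose_transpose]
    rw [e, frobSq_transpose]
    refine (frobSq_mul_le _ _).trans (mul_le_mul ?_ hP (frobSq_nonneg _) (by positivity))
    rw [opNorm_transpose]
    exact pow_le_pow_left₀ (opNorm_nonneg _) (opNorm_fromRows_le_max A B) 2
  refine (Real.sqrt_le_sqrt h1).trans_eq ?_
  rw [Real.sqrt_mul (by positivity), Real.sqrt_sq (by positivity), mul_assoc]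

lemma opNorm_add_swap (A B C D : Matrix ι ι ℝ) :
    opNorm (Cᵀ * A + Dᵀ * B) = opNorm (Aᵀ * C + Bᵀ * D) := by
  rw [← opNorm_transpose]
  simp

/-! ### The limit for an infinite exponent -/

lemma max_rpow_le_opNorm_gramPowSum (A B : Matrix ι ι ℝ) {r : ℝ} (hr : 0 < r) :
    max (opNorm A) (opNorm B) ^ r ≤ opNorm (gramPowSum (r / 2) A B) := by
  have hone : ∀ A B : Matrix ι ι ℝ, opNorm A ^ r ≤ opNorm (gramPowSum (r / 2) A B) := by
    intro A B
    refine le_trans (le_of_eq ?_) (opNorm_le_opNorm_add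
      ((posSemidef_transpose_mul A).cfc_rpow (r / 2))
      ((posSemidef_transpose_mul B).cfc_rpow (r / 2)))
    rw [opNorm_cfc_rpow (posSemidef_transpose_mul A) (half_pos hr), opNorm_transpose_mul_self,
      ← Real.rpow_two, ← Real.rpow_mul (opNorm_nonneg _), mul_div_cancel₀ _ two_ne_zero]
  rcases max_choice (opNorm A) (opNorm B) with h | h <;> rw [h]
  · exact hone A B
  · rw [gramPowSum, add_comm]
    exact hone B A

lemma opNorm_gramPowSum_le (A B : Matrix ι ι ℝ) {r : ℝ} (hr : 0 < r) :
    opNorm (gramPowSum (r / 2) A B) ≤ 2 * max (opNorm A) (opNorm B) ^ r := by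
  have hone : ∀ A : Matrix ι ι ℝ, opNorm (cfc (fun x : ℝ => x ^ (r / 2)) (Aᵀ * A)) =
      opNorm A ^ r := fun A => by
    rw [opNorm_cfc_rpow (posSemidef_transpose_mul A) (half_pos hr), opNorm_transpose_mul_self,
      ← Real.rpow_two, ← Real.rpow_mul (opNorm_nonneg _), mul_div_cancel₀ _ two_ne_zero]
  refine (opNorm_add_le _ _).trans ?_
  rw [hone, hone, two_mul]
  exact add_le_add
    (Real.rpow_le_rpow (opNorm_nonneg _) (le_max_left _ _) hr.le)
    (Real.rpow_le_rpow (opNorm_nonneg _) (le_max_right _ _) hr.le)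

/-- For every quantity `N` equivalent to the operator norm on the matrices `|A| ^ r + |B| ^ r`, the
`r`-th roots of its values tend to `max ‖A‖ ‖B‖`: the constants disappear in the limit. -/
lemma tendsto_gramPowSum (A B : Matrix ι ι ℝ) {N : ℝ → ℝ} {c c' : ℝ} (hc : 0 < c) (hc' : 0 < c')
    (h1 : ∀ r, c * opNorm (gramPowSum (r / 2) A B) ≤ N r)
    (h2 : ∀ r, N r ≤ c' * opNorm (gramPowSum (r / 2) A B)) :
    Tendsto (fun r : ℝ => N r ^ (1 / r)) atTop (𝓝 (max (opNorm A) (opNorm B))) := by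
  set m := max (opNorm A) (opNorm B)
  have hm : 0 ≤ m := le_max_of_le_left (opNorm_nonneg A)
  have hlim : ∀ {a : ℝ}, 0 < a →
      Tendsto (fun r : ℝ => a ^ (1 / r) * m) atTop (𝓝 m) := fun {a} ha => by
    have h0 : Tendsto (fun r : ℝ => 1 / r) atTop (𝓝 0) := by
      simpa using tendsto_inv_atTop_zero (𝕜 := ℝ)
    have := (tendsto_const_nhds (x := a)).rpow h0 (Or.inl ha.ne')
    simpa using this.mul_const m
  have hroot : ∀ {a r : ℝ}, 0 < a → 0 < r → a ^ (1 / r) * m = (a * m ^ r) ^ (1 / r) := by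
    intro a r ha hr
    rw [Real.mul_rpow ha.le (Real.rpow_nonneg hm _), ← Real.rpow_mul hm,
      mul_one_div_cancel hr.ne', Real.rpow_one]
  refine tendsto_of_tendsto_of_tendsto_of_le_of_le' (hlim hc)
    (hlim (a := c' * 2) (by positivity)) ?_ ?_
  · filter_upwards [eventually_gt_atTop 0] with r hr
    rw [hroot hc hr]
    refine Real.rpow_le_rpow (by positivity) (le_trans ?_ (h1 r)) (by positivity)
    exact mul_le_mul_of_nonneg_left (max_rpow_le_opNorm_gramPowSum A B hr) hc.le
  · filter_upwards [eventually_gt_atTop 0] with r hr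
    rw [hroot (by positivity) hr, mul_assoc]
    refine Real.rpow_le_rpow ((mul_nonneg hc.le (opNorm_nonneg _)).trans (h1 r))
      ((h2 r).trans ?_) (by positivity)
    exact mul_le_mul_of_nonneg_left (opNorm_gramPowSum_le A B hr) hc'.le

end Matrix

/-! ### Block circulant matrices of tensors -/

namespace Tensor3

open Matrix

section

variable {n₁ n₂ n₄ n n₃ : ℕ}

lemma bcirc_add (A B : Tensor3 n₁ n₂ n₃) : bcirc (A + B) = bcirc A + bcirc B := rfl

lemma specNorm_eq_opNorm (A : Tensor3 n n n₃) : specNorm A = opNorm (bcirc A) := rfl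

lemma frobNorm_nonneg (A : Tensor3 n₁ n₂ n₃) : 0 ≤ frobNorm A := Real.sqrt_nonneg _

variable [NeZero n₃]

lemma bcirc_tprod (A : Tensor3 n₁ n₂ n₃) (B : Tensor3 n₂ n₄ n₃) :
    bcirc (tprod A B) = bcirc A * bcirc B := by
  ext ⟨k, i⟩ ⟨l, j⟩
  simp only [bcirc, tprod, fold, unfold, mul_apply, of_apply, Fintype.sum_prod_type]
  rw [← Equiv.sum_comp (Equiv.subRight l)]
  refine Finset.sum_congr rfl fun m _ => Finset.sum_congr rfl fun a _ => ?_
  rw [Equiv.subRight_apply, sub_sub_sub_cancel_right]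

lemma bcirc_ttranspose (A : Tensor3 n₁ n₂ n₃) : bcirc (ttranspose A) = (bcirc A)ᵀ := by
  ext ⟨k, i⟩ ⟨l, j⟩
  simp [bcirc, ttranspose]

/-- A function of a block circulant matrix is block circulant, since block circulant matrices are
the ones that commute with the cyclic shifts of the blocks. -/
lemma bcirc_tpow (X : Tensor3 n n n₃) (r : ℝ) :
    bcirc (tpow X r) = cfc (fun x : ℝ => x ^ r) (bcirc X) := by
  set F := cfc (fun x : ℝ => x ^ r) (bcirc X) with hF
  have hshift : ∀ c k l i j, F (k + c, i) (l + c, j) = F (k, i) (l, j) := by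
    intro c k l i j
    set σ : Fin n₃ × Fin n ≃ Fin n₃ × Fin n := (Equiv.addRight c).prodCongr (Equiv.refl _) with hσ
    have hX : Commute (bcirc X) (σ.toPEquiv.toMatrix : Matrix _ _ ℝ) := by
      rw [Commute, SemiconjBy, PEquiv.toMatrix_toPEquiv_mul, PEquiv.mul_toMatrix_toPEquiv]
      ext ⟨k, i⟩ ⟨l, j⟩
      simp [bcirc, hσ, sub_eq_add_neg, add_assoc, add_comm, add_left_comm]
    have h := hX.cfc_real (fun x : ℝ => x ^ r)
    rw [← hF, Commute, SemiconjBy, PEquiv.toMatrix_toPEquiv_mul, PEquiv.mul_toMatrix_toPEquiv] at h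
    have := congrFun (congrFun h (k, i)) (l + c, j)
    simpa [hσ] using this.symm
  ext ⟨k, i⟩ ⟨l, j⟩
  have h0 : (F * firstBlock n n₃) (k - l, i) j = F (k - l, i) (0, j) := by
    rw [mul_apply, Fintype.sum_eq_single (0, j)]
    · simp [firstBlock]
    · rintro ⟨a, b⟩ hab
      have : ¬(a = 0 ∧ b = j) := fun h => hab (by rw [h.1, h.2])
      simp [firstBlock, this]
  change (F * firstBlock n n₃) (k - l, i) j = F (k, i) (l, j)
  rw [h0, ← hshift l]
  simp

lemma bcirc_tpow_tabs (A : Tensor3 n n n₃) (r : ℝ) :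
    bcirc (tpow (tabs A) r) = cfc (fun x : ℝ => x ^ (r / 2)) ((bcirc A)ᵀ * bcirc A) := by
  have hG := posSemidef_transpose_mul (bcirc A)
  rw [bcirc_tpow, tabs, bcirc_tpow, bcirc_tprod, bcirc_ttranspose]
  refine (cfc_comp' (fun x : ℝ => x ^ r) (fun x : ℝ => x ^ (1 / 2 : ℝ)) _
    ((Matrix.finite_real_spectrum.image _).continuousOn _)
    (Matrix.finite_real_spectrum.continuousOn _) hG.1).symm.trans (cfc_congr fun x hx => ?_)
  rw [hG.1.spectrum_real_eq_range_eigenvalues] at hx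
  obtain ⟨i, rfl⟩ := hx
  rw [← Real.rpow_mul (hG.eigenvalues_nonneg i)]
  congr 1
  ring

lemma bcirc_powSum (A B : Tensor3 n n n₃) (r : ℝ) :
    bcirc (tpow (tabs A) r + tpow (tabs B) r) = gramPowSum (r / 2) (bcirc A) (bcirc B) := by
  rw [bcirc_add, bcirc_tpow_tabs, bcirc_tpow_tabs, gramPowSum]

lemma bcirc_tprod_add (A B C D : Tensor3 n n n₃) :
    bcirc (tprod (ttranspose C) A + tprod (ttranspose D) B) =
      (bcirc C)ᵀ * bcirc A + (bcirc D)ᵀ * bcirc B := by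
  simp only [bcirc_add, bcirc_tprod, bcirc_ttranspose]

/-- Every slice occurs in each of the `n₃` block columns of the block circulant matrix. -/
lemma frobSq_bcirc (A : Tensor3 n₁ n₂ n₃) : frobSq (bcirc A) = n₃ * frobNorm A ^ 2 := by
  have hnn : 0 ≤ ∑ k, ∑ i, ∑ j, |A k i j| ^ 2 := by positivity
  rw [frobNorm, Real.sq_sqrt hnn, ← frobSq_transpose]
  simp only [frobSq, bcirc, transpose_apply, of_apply, Fintype.sum_prod_type, sq_abs]
  have h : ∀ l : Fin n₃, ∑ j, ∑ k, ∑ i, A (k - l) i j ^ 2 = ∑ k, ∑ i, ∑ j, A k i j ^ 2 := by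
    intro l
    rw [Finset.sum_comm, ← Equiv.sum_comp (Equiv.subRight l) fun k => ∑ i, ∑ j, A k i j ^ 2]
    exact Finset.sum_congr rfl fun k _ => Finset.sum_comm
  simp [h]

lemma sqrt_frobSq_bcirc (A : Tensor3 n₁ n₂ n₃) :
    √(frobSq (bcirc A)) = (n₃ : ℝ) ^ (1 / 2 : ℝ) * frobNorm A := by
  rw [frobSq_bcirc, Real.sqrt_mul (by positivity), Real.sqrt_sq (frobNorm_nonneg A),
    Real.sqrt_eq_rpow]

end

/-! ### Hölder-type inequalities and limits for tensors -/

variable {n n₃ : ℕ} [NeZero n₃]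

lemma holderFactor_top (N : Tensor3 n n n₃ → ℝ) (A B : Tensor3 n n n₃) :
    holderFactor N ∞ A B = max (opNorm (bcirc A)) (opNorm (bcirc B)) := if_pos rfl

lemma holderFactor_of_ne_top (N : Tensor3 n n n₃ → ℝ) {p : ℝ≥0∞} (hp : p ≠ ∞)
    (A B : Tensor3 n n n₃) : holderFactor N p A B = powSumNorm N p.toReal A B := if_neg hp

lemma powSumNorm_specNorm (A B : Tensor3 n n n₃) (r : ℝ) : powSumNorm specNorm r A B =
    opNorm (gramPowSum (r / 2) (bcirc A) (bcirc B)) ^ (1 / r) := by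
  rw [powSumNorm, specNorm_eq_opNorm, bcirc_powSum]

lemma sqrt_frobSq_gramPowSum (A B : Tensor3 n n n₃) (r : ℝ) :
    √(frobSq (gramPowSum (r / 2) (bcirc A) (bcirc B))) =
      (n₃ : ℝ) ^ (1 / 2 : ℝ) * frobNorm (tpow (tabs A) r + tpow (tabs B) r) := by
  rw [← bcirc_powSum, sqrt_frobSq_bcirc]

lemma tendsto_powSumNorm_specNorm (A B : Tensor3 n n n₃) :
    Tendsto (fun r : ℝ => powSumNorm specNorm r A B) atTop (𝓝 (holderFactor specNorm ∞ A B)) := by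
  simp only [powSumNorm_specNorm, holderFactor_top]
  exact tendsto_gramPowSum _ _ one_pos one_pos (fun r => (one_mul _).le) (fun r => (one_mul _).ge)

lemma tendsto_powSumNorm_frobNorm (A B : Tensor3 n n n₃) :
    Tendsto (fun r : ℝ => powSumNorm frobNorm r A B) atTop (𝓝 (holderFactor frobNorm ∞ A B)) := by
  have hn : (0 : ℝ) < (n₃ : ℝ) := Nat.cast_pos.mpr (NeZero.pos n₃)
  set c : ℝ := (n₃ : ℝ) ^ (1 / 2 : ℝ)
  have hc : 0 < c := by positivity
  rw [holderFactor_top]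
  -- the added `1` keeps the constant positive when `n = 0`
  refine tendsto_gramPowSum (c := c⁻¹) (c' := c⁻¹ * √(n₃ * n + 1)) _ _ (by positivity)
    (by positivity) (fun r => ?_) (fun r => ?_)
  · rw [inv_mul_le_iff₀ hc, ← sqrt_frobSq_gramPowSum]
    exact Real.le_sqrt_of_sq_le (opNorm_sq_le_frobSq (posSemidef_gramPowSum _ _ _))
  · rw [mul_assoc, le_inv_mul_iff₀ hc, ← sqrt_frobSq_gramPowSum, mul_comm,
      ← Real.sqrt_sq (opNorm_nonneg _), ← Real.sqrt_mul (sq_nonneg _)]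
    refine Real.sqrt_le_sqrt ?_
    have h := frobSq_mul_le (gramPowSum (r / 2) (bcirc A) (bcirc B))
      (1 : Matrix (Fin n₃ × Fin n) (Fin n₃ × Fin n) ℝ)
    rw [Matrix.mul_one] at h
    refine h.trans (mul_le_mul_of_nonneg_left ?_ (sq_nonneg _))
    simp [frobSq, one_apply, ite_pow]

lemma frobNorm_holder (A B C D : Tensor3 n n n₃) {p q : ℝ} (hpq : p.HolderConjugate q) :
    frobNorm (tprod (ttranspose C) A + tprod (ttranspose D) B) ≤ 2 ^ |1 / p - 1 / 2| *
      (powSumNorm frobNorm p A B * powSumNorm frobNorm q C D) := by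
  have hn : (0 : ℝ) < (n₃ : ℝ) := Nat.cast_pos.mpr (NeZero.pos n₃)
  have h := frobenius_holder (bcirc A) (bcirc B) (bcirc C) (bcirc D) hpq
  have hc : 0 < (n₃ : ℝ) ^ (1 / 2 : ℝ) := by positivity
  rw [← bcirc_tprod_add, sqrt_frobSq_bcirc, sqrt_frobSq_gramPowSum, sqrt_frobSq_gramPowSum] at h
  set c : ℝ := (n₃ : ℝ) ^ (1 / 2 : ℝ)
  rw [Real.mul_rpow hc.le (frobNorm_nonneg _), Real.mul_rpow hc.le (frobNorm_nonneg _)] at h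
  have hcc : c ^ (1 / p) * c ^ (1 / q) = c := by
    rw [← Real.rpow_add hc, one_div, one_div, hpq.inv_add_inv_eq_one, Real.rpow_one]
  refine le_of_mul_le_mul_left (h.trans_eq ?_) hc
  rw [powSumNorm, powSumNorm]
  conv_rhs => rw [← hcc]
  ring

lemma frobNorm_holder_top (A B C D : Tensor3 n n n₃) :
    frobNorm (tprod (ttranspose C) A + tprod (ttranspose D) B) ≤ 2 ^ (1 / 2 : ℝ) *
      (holderFactor frobNorm ∞ A B * powSumNorm frobNorm 1 C D) := by
  have hn : (0 : ℝ) < (n₃ : ℝ) := Nat.cast_pos.mpr (NeZero.pos n₃)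
  have h := frobenius_holder_top (bcirc A) (bcirc B) (bcirc C) (bcirc D)
  have hc : 0 < (n₃ : ℝ) ^ (1 / 2 : ℝ) := by positivity
  rw [← bcirc_tprod_add, sqrt_frobSq_bcirc, sqrt_frobSq_gramPowSum] at h
  refine le_of_mul_le_mul_left (h.trans_eq ?_) hc
  rw [powSumNorm, holderFactor_top, div_one, Real.rpow_one]
  ring

lemma specNorm_holder (A B C D : Tensor3 n n n₃) {p q : ℝ} (hpq : p.HolderConjugate q) :
    specNorm (tprod (ttranspose C) A + tprod (ttranspose D) B) ≤ 2 ^ |1 / p - 1 / 2| *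
      (powSumNorm specNorm p A B * powSumNorm specNorm q C D) := by
  rw [specNorm_eq_opNorm, bcirc_tprod_add, powSumNorm_specNorm, powSumNorm_specNorm]
  exact opNorm_holder _ _ _ _ hpq

lemma specNorm_holder_top (A B C D : Tensor3 n n n₃) :
    specNorm (tprod (ttranspose C) A + tprod (ttranspose D) B) ≤ 2 ^ (1 / 2 : ℝ) *
      (holderFactor specNorm ∞ A B * powSumNorm specNorm 1 C D) := by
  rw [specNorm_eq_opNorm, bcirc_tprod_add, powSumNorm_specNorm, holderFactor_top, div_one,
    Real.rpow_one]
  exact opNorm_holder_top _ _ _ _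

lemma specNorm_add_swap (A B C D : Tensor3 n n n₃) :
    specNorm (tprod (ttranspose C) A + tprod (ttranspose D) B) =
      specNorm (tprod (ttranspose A) C + tprod (ttranspose B) D) := by
  rw [specNorm_eq_opNorm, specNorm_eq_opNorm, bcirc_tprod_add, bcirc_tprod_add, opNorm_add_swap]

lemma frobNorm_add_swap (A B C D : Tensor3 n n n₃) :
    frobNorm (tprod (ttranspose C) A + tprod (ttranspose D) B) =
      frobNorm (tprod (ttranspose A) C + tprod (ttranspose B) D) := by
  have hn : (n₃ : ℝ) ^ (1 / 2 : ℝ) ≠ 0 :=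
    (Real.rpow_pos_of_pos (Nat.cast_pos.mpr (NeZero.pos n₃)) _).ne'
  refine mul_left_cancel₀ hn ?_
  rw [← sqrt_frobSq_bcirc, ← sqrt_frobSq_bcirc, bcirc_tprod_add, bcirc_tprod_add, frobSq_add_swap]

/-- The inequality for all conjugate exponents follows from the finite case and the case `p = ∞`;
the case `q = ∞` is the latter for the transposed tensor. -/
lemma holderFactor_le_of_cases {N : Tensor3 n n n₃ → ℝ}
    (hfin : ∀ (A B C D : Tensor3 n n n₃) {p q : ℝ}, p.HolderConjugate q →
      N (tprod (ttranspose C) A + tprod (ttranspose D) B) ≤ 2 ^ |1 / p - 1 / 2| *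
        (powSumNorm N p A B * powSumNorm N q C D))
    (htop : ∀ A B C D : Tensor3 n n n₃,
      N (tprod (ttranspose C) A + tprod (ttranspose D) B) ≤ 2 ^ (1 / 2 : ℝ) *
        (holderFactor N ∞ A B * powSumNorm N 1 C D))
    (hswap : ∀ A B C D : Tensor3 n n n₃, N (tprod (ttranspose C) A + tprod (ttranspose D) B) =
      N (tprod (ttranspose A) C + tprod (ttranspose B) D))
    {p q : ℝ≥0∞} (hpq : p⁻¹ + q⁻¹ = 1) (A B C D : Tensor3 n n n₃) :
    (2 : ℝ) ^ (-|(p⁻¹).toReal - 1 / 2|) *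
        N (tprod (ttranspose C) A + tprod (ttranspose D) B) ≤
      holderFactor N p A B * holderFactor N q C D := by
  rw [Real.rpow_neg zero_le_two, inv_mul_le_iff₀ (by positivity)]
  rcases eq_or_ne p ∞ with rfl | hp
  · have hq : q = 1 := by simpa using hpq
    have e : |(∞⁻¹ : ℝ≥0∞).toReal - 1 / 2| = 1 / 2 := by norm_num [abs_of_neg]
    rw [e, hq, holderFactor_of_ne_top N ENNReal.one_ne_top, ENNReal.toReal_one]
    exact htop A B C D
  rcases eq_or_ne q ∞ with rfl | hq
  · have hp1 : p = 1 := by simpa using hpq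
    have e : |(p⁻¹ : ℝ≥0∞).toReal - 1 / 2| = 1 / 2 := by rw [hp1]; norm_num [abs_of_pos]
    rw [e, hp1, holderFactor_of_ne_top N ENNReal.one_ne_top, ENNReal.toReal_one, hswap,
      mul_comm (powSumNorm N 1 A B)]
    exact htop C D A B
  · have hpq' : p.toReal.HolderConjugate q.toReal := by
      have : p.HolderConjugate q := ⟨by simpa using hpq⟩
      exact ENNReal.HolderConjugate.toReal_of_ne_top hp hq
    rw [holderFactor_of_ne_top N hp, holderFactor_of_ne_top N hq, ENNReal.toReal_inv, ← one_div]
    exact hfin A B C D hpq'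

end Tensor3

theorem mainTheorem8 (n n₃ : ℕ) [NeZero n₃] (p q : ℝ≥0∞) (hp : 1 ≤ p) (hq : 1 ≤ q)
    (hpq : p⁻¹ + q⁻¹ = 1) (A B C D : Tensor3 n n n₃) :
    ((2 : ℝ) ^ (-|(p⁻¹).toReal - 1 / 2|) *
        Tensor3.frobNorm (Tensor3.tprod (Tensor3.ttranspose C) A +
          Tensor3.tprod (Tensor3.ttranspose D) B) ≤
      (n₃ : ℝ) ^ ((p⁻¹).toReal / 2 + (q⁻¹).toReal / 2 - 1 / 2) *
        Tensor3.holderFactor Tensor3.frobNorm p A B *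
        Tensor3.holderFactor Tensor3.frobNorm q C D) ∧
    ((2 : ℝ) ^ (-|(p⁻¹).toReal - 1 / 2|) *
        Tensor3.specNorm (Tensor3.tprod (Tensor3.ttranspose C) A +
          Tensor3.tprod (Tensor3.ttranspose D) B) ≤
      Tensor3.holderFactor Tensor3.specNorm p A B *
        Tensor3.holderFactor Tensor3.specNorm q C D) ∧
    -- the values used at an infinite exponent are the limits of those at finite exponents
    Tendsto (fun r : ℝ => Tensor3.powSumNorm Tensor3.frobNorm r A B) atTop
      (𝓝 (Tensor3.holderFactor Tensor3.frobNorm ∞ A B)) ∧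
    Tendsto (fun r : ℝ => Tensor3.powSumNorm Tensor3.specNorm r A B) atTop
      (𝓝 (Tensor3.holderFactor Tensor3.specNorm ∞ A B)) := by
  refine ⟨?_, ?_, Tensor3.tendsto_powSumNorm_frobNorm A B, Tensor3.tendsto_powSumNorm_specNorm A B⟩
  · -- the powers of `n₃` that the three Frobenius norms contribute cancel
    have e : (p⁻¹).toReal / 2 + (q⁻¹).toReal / 2 - 1 / 2 = 0 := by
      have h := congrArg ENNReal.toReal hpq
      rw [ENNReal.toReal_add (by simpa using (zero_lt_one.trans_le hp).ne')
        (by simpa using (zero_lt_one.trans_le hq).ne'), ENNReal.toReal_one] at h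
      linarith
    rw [e, Real.rpow_zero, one_mul]
    exact Tensor3.holderFactor_le_of_cases Tensor3.frobNorm_holder Tensor3.frobNorm_holder_top
      Tensor3.frobNorm_add_swap hpq A B C D
  · exact Tensor3.holderFactor_le_of_cases Tensor3.specNorm_holder Tensor3.specNorm_holder_top
      Tensor3.specNorm_add_swap hpq A B C D
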